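/- Let $\mathbb K=\mathbb R$ or $\mathbb C$; all Lie groups are finite-dimensional over $\mathbb K$, and maps are $C^\infty$ if $\mathbb K=\mathbb R$ and holomorphic if $\mathbb K=\mathbb C$. Lie subgroups may be immersed. For a Lie group $A$ put $(\mathcal L_Xf)(a)=\frac{d}{dt}f(e^{tX}a)|_{t=0}$. **Setting.** Let $G$ be a connected Lie group with Lie algebra $\mathcal G$, and let $R\in\mathcal G\wedge\mathcal G$ be such that $$\mathcal I_R:=[R_{12},R_{13}]+[R_{12},R_{23}]+[R_{13},R_{23}]$$ is $G$-invariant. Give $G$ the Poisson-Lie structure $\{g_1,g_2\}=[g_1g_2,R]$, i.e. the bivector at $g$ is the left translate of $R$ minus the right translate of $R$. For a connected Poisson-Lie subgroup $K\subseteq G$ with Lie algebra $\mathcal K$, the dual $\mathcal K^*$ is a Lie algebra with bracket $\langle[\alpha,\beta],X\rangle=-\langle\alpha\otimes\beta,[X\otimes1+1\otimes X,R]\rangle$, where $X\in\mathcal K$ (the tensor lies in $\mathcal K\wedge\mathcal K$). Let $K^*$ be a dual group, i.e. a Lie group with Lie algebra $\mathcal K^*$, and let $D(K,K^*)$ be a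 Drinfeld double: a Lie group containing $K$ and $K^*$ as Lie subgroups, with Lie algebra $\mathcal K\oplus\mathcal K^*$, for which the symmetric form $\langle\langle\,,\rangle\rangle$ that makes $\mathcal K$ and $\mathcal K^*$ isotropic and pairs them canonically is invariant. For $\kappa\in K^*$ and $X\in\mathcal K$, $\kappa X\kappa^{-1}$ denotes the adjoint action in $D(K,K^*)$. Subscripts such as $(\cdot)_{\mathcal K^*}$ denote components in a direct sum. The infinitesimal dressing action of $X\in\mathcal K$ on $K^*$ is $\mathrm{dress}_X\kappa=\kappa(\kappa^{-1}X\kappa)_{\mathcal K^*}$. Let $\check K^*\subseteq K^*$ be open. A smooth (resp. holomorphic) map $r:\check K^*\to\mathcal G\wedge\mathcal G$ is a *triangular Poisson-Lie dynamical $r$-matrix for $K\subseteq G$* if on $\check K^*$ it is infinitesimally equivariant, $$\mathrm{dress}_Xr=[X\otimes1+1\otimes X,r]\qquad\text{for all }X\in\mathcal K,$$ and satisfies the PL-CDYBE with right-hand side $\mathcal I_R$, $$[R_{12}+r_{12},R_{23}+r_{23}]+\sum_aK^a_1\,\mathcal L_{K_a}r_{23}+\text{cycl. perm.}=\mathcal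 I_R,$$ where $\{K^a\}\subset\mathcal K$ and $\{K_a\}\subset\mathcal K^*$ are dual bases. **Hypotheses.** Let $K$, $K^*$, $D(K,K^*)$ be as above, let $H\subset K$ be a connected Lie subgroup with Lie algebra $\mathcal H$ that is a Poisson-Lie subgroup, and let $\mathcal K=\mathcal H\oplus\mathcal M$ be a vector space decomposition. Identify $\mathcal H^*$ with $\mathcal M^\perp\subset\mathcal K^*$ and $\mathcal M^*$ with $\mathcal H^\perp\subset\mathcal K^*$. Suppose that $\mathcal H^*\subset\mathcal K^*$ is a Lie subalgebra, that $\mathcal H^\perp\subset\mathcal K^*$ is a Lie ideal, and that $[\mathcal H,\mathcal M]\subset\mathcal M$. Let $H^*\subset K^*$ be the connected Lie subgroup with Lie algebra $\mathcal H^*$, and let $D(H,H^*)$ be a Drinfeld double of $H$ and $H^*$. Let $r:\check K^*\to\mathcal G\wedge\mathcal G$ be a (possibly zero) triangular Poisson-Lie dynamical $r$-matrix for $K\subseteq G$, let $\{M^i\}$ be a basis of $\mathcal M$, and let $\check H^*$ be a non-empty open subset of $H^*$, contained in $\check K^*$, on which the matrix $$C^{ij}(\lambda)=\langle\langle(\lambda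 M^i\lambda^{-1})_{\mathcal M},\lambda M^j\lambda^{-1}\rangle\rangle$$ is invertible. For $\lambda\in\check H^*$ put $$\rho(\lambda)=\sum_{i,j}(C^{-1}(\lambda))_{ij}\,(\lambda M^i\lambda^{-1})_{\mathcal M}\otimes(\lambda M^j\lambda^{-1})_{\mathcal M}.$$ **Corollary 3.7.** $H^*$ is a dual group of $H\subset G$, and $$r^*=r+\rho:\check H^*\to\mathcal G\wedge\mathcal G$$ is a triangular Poisson-Lie dynamical $r$-matrix for $H\subset G$. That is, $r^*$ is smooth (resp. holomorphic) and antisymmetric, it is infinitesimally equivariant for the dressing action of $\mathcal H$ on $H^*$ defined by $D(H,H^*)$, and it satisfies the PL-CDYBE for $H\subset G$ with right-hand side $\mathcal I_{R,r^*}=\mathcal I_R$. In particular (case $r=0$), $\rho$ is a triangular Poisson-Lie dynamical $r$-matrix for $H\subset G$, and it is the Enriquez–Etingof–Marshall family $\sigma_{\mathcal H}^{\mathcal G}$: for each $\lambda\in\check H^*$, $\rho(\lambda)$ is the unique element $\sigma=\sum_iM^i\otimes N_i$ of $\mathcal M\wedge\mathcal M$ (with $N_i\in\mathcal M$) such that for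 all $u,v\in\mathcal M$ $$\langle\langle(\lambda^{-1}u\lambda)_{\mathcal M},\lambda^{-1}v\lambda\rangle\rangle=\sum_i\langle\langle(\lambda^{-1}u\lambda)_{\mathcal M},\lambda^{-1}M^i\lambda\rangle\rangle\,\langle\langle(\lambda^{-1}v\lambda)_{\mathcal M},\lambda^{-1}N_i\lambda\rangle\rangle.$$ -/

import Mathlib

open scoped Manifold ContDiff TensorProduct

noncomputable section

namespace PoissonLie

/-! ### Finite-dimensional Lie groups over `ℝ` or `ℂ` -/

/-- A finite-dimensional smooth Lie group over `𝕜 = ℝ`, or complex Lie group over `𝕜 = ℂ`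
(over `ℂ`, smoothness of class `C^∞` is holomorphy). -/
structure FDLieGroup (𝕜 : Type*) [RCLike 𝕜] where
  /-- The model vector space. -/
  E : Type*
  /-- The underlying set. -/
  carrier : Type*
  [normedAddCommGroup : NormedAddCommGroup E]
  [normedSpace : NormedSpace 𝕜 E]
  [finiteDimensional : FiniteDimensional 𝕜 E]
  [topologicalSpace : TopologicalSpace carrier]
  [chartedSpace : ChartedSpace E carrier]
  [group : Group carrier]
  [lieGroup : LieGroup 𝓘(𝕜, E) ∞ carrier]

attribute [instance] FDLieGroup.normedAddCommGroup FDLieGroup.normedSpace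
  FDLieGroup.finiteDimensional FDLieGroup.topologicalSpace FDLieGroup.chartedSpace
  FDLieGroup.group FDLieGroup.lieGroup

instance instCoeSort {𝕜 : Type*} [RCLike 𝕜] : CoeSort (FDLieGroup 𝕜) (Type _) :=
  ⟨FDLieGroup.carrier⟩

instance instLEInfty {𝕜 : Type*} [RCLike 𝕜] : ENat.LEInfty (minSmoothness 𝕜 3) :=
  ⟨by rw [minSmoothness_of_isRCLikeNormedField]; exact ENat.LEInfty.out⟩

instance instComplete {𝕜 : Type*} [RCLike 𝕜] (A : FDLieGroup 𝕜) : CompleteSpace A.E :=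
  FiniteDimensional.complete 𝕜 A.E

variable {𝕜 : Type*} [RCLike 𝕜]

/-- The Lie algebra of `A`: the tangent space at `1`, with the bracket of left-invariant vector
fields (for matrix groups, the commutator). -/
abbrev FDLieGroup.lie (A : FDLieGroup 𝕜) : Type _ := GroupLieAlgebra 𝓘(𝕜, A.E) A

instance instFiniteLie (A : FDLieGroup 𝕜) : Module.Finite 𝕜 A.lie :=
  inferInstanceAs (Module.Finite 𝕜 A.E)

/-- The differential at `1` of a group homomorphism. -/
def dHom {A B : FDLieGroup 𝕜} (i : A →* B) : A.lie →ₗ[𝕜] B.lie :=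
  (show A.E →L[𝕜] B.E from mfderiv 𝓘(𝕜, A.E) 𝓘(𝕜, B.E) i 1).toLinearMap

/-- The adjoint action `X ↦ a X a⁻¹` of `A` on its Lie algebra: the differential at `1` of
`x ↦ a x a⁻¹`. -/
def Ad {A : FDLieGroup 𝕜} (a : A) : A.lie →ₗ[𝕜] A.lie :=
  (show A.E →L[𝕜] A.E from
    mfderiv 𝓘(𝕜, A.E) 𝓘(𝕜, A.E) (fun x : A => a * x * a⁻¹) 1).toLinearMap

/-- `i` exhibits `A` as a (possibly only immersed) Lie subgroup of `B`. -/
structure IsLieSubgroup {A B : FDLieGroup 𝕜} (i : A →* B) : Prop where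
  smooth : ContMDiff 𝓘(𝕜, A.E) 𝓘(𝕜, B.E) ∞ i
  injective : Function.Injective i
  immersion : Function.Injective (dHom i)

/-- `(L_X f)(a) = d/dt f(e^{tX} a)` at `t = 0`, i.e. the differential of `x ↦ f (x a)` at `x = 1`,
applied to `X`. -/
def leftDeriv {A : FDLieGroup 𝕜} (f : A → 𝕜) (X : A.lie) (a : A) : 𝕜 :=
  mfderiv 𝓘(𝕜, A.E) 𝓘(𝕜, 𝕜) (fun x : A => f (x * a)) 1 X

/-- `(R_X f)(a) = d/dt f(a e^{tX})` at `t = 0`. -/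
def rightDeriv {A : FDLieGroup 𝕜} (f : A → 𝕜) (X : A.lie) (a : A) : 𝕜 :=
  mfderiv 𝓘(𝕜, A.E) 𝓘(𝕜, 𝕜) (fun x : A => f (a * x)) 1 X

section VectorValued

variable {V : Type*} [AddCommGroup V] [Module 𝕜 V] [Module.Finite 𝕜 V] {A : FDLieGroup 𝕜}

/-- Left derivative of a function with values in a finite-dimensional space, taken
componentwise in a basis. -/
def leftDerivVec (F : A → V) (X : A.lie) (a : A) : V :=
  ∑ n, leftDeriv (fun x => (Module.finBasis 𝕜 V).repr (F x) n) X a • Module.finBasis 𝕜 V n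

/-- Right derivative of a function with values in a finite-dimensional space, taken
componentwise in a basis. -/
def rightDerivVec (F : A → V) (X : A.lie) (a : A) : V :=
  ∑ n, rightDeriv (fun x => (Module.finBasis 𝕜 V).repr (F x) n) X a • Module.finBasis 𝕜 V n

/-- Smoothness (holomorphy, over `ℂ`) on `U` of a function with values in a finite-dimensional
space. -/
def SmoothOn (F : A → V) (U : Set A) : Prop :=
  ∀ ψ : Module.Dual 𝕜 V, ContMDiffOn 𝓘(𝕜, A.E) 𝓘(𝕜, 𝕜) ∞ (fun x => ψ (F x)) U

end VectorValued

/-! ### Tensors over a Lie algebra -/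

section Tensors

variable {L : Type*} [LieRing L] [LieAlgebra 𝕜 L]

/-- `X ⊗ Y ↦ [X, Y]`. -/
def lieMul : L ⊗[𝕜] L →ₗ[𝕜] L :=
  TensorProduct.lift (LieAlgebra.ad 𝕜 L : L →ₗ[𝕜] Module.End 𝕜 L)

/-- `[A₁₂, B₁₃]`: bilinear, `(a ⊗ b, c ⊗ d) ↦ [a, c] ⊗ b ⊗ d`. -/
def br12_13 (A B : L ⊗[𝕜] L) : L ⊗[𝕜] (L ⊗[𝕜] L) :=
  TensorProduct.map lieMul LinearMap.id
    (TensorProduct.tensorTensorTensorComm 𝕜 L L L L (A ⊗ₜ[𝕜] B))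

/-- `[A₁₂, B₂₃]`: bilinear, `(a ⊗ b, c ⊗ d) ↦ a ⊗ [b, c] ⊗ d`. -/
def br12_23 (A B : L ⊗[𝕜] L) : L ⊗[𝕜] (L ⊗[𝕜] L) :=
  TensorProduct.map LinearMap.id
    (TensorProduct.map lieMul LinearMap.id ∘ₗ (TensorProduct.assoc 𝕜 L L L).symm.toLinearMap)
    (TensorProduct.assoc 𝕜 L L (L ⊗[𝕜] L) (A ⊗ₜ[𝕜] B))

/-- `[A₁₃, B₂₃]`: bilinear, `(a ⊗ b, c ⊗ d) ↦ a ⊗ c ⊗ [b, d]`. -/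
def br13_23 (A B : L ⊗[𝕜] L) : L ⊗[𝕜] (L ⊗[𝕜] L) :=
  TensorProduct.map LinearMap.id (TensorProduct.map LinearMap.id lieMul)
    (TensorProduct.assoc 𝕜 L L (L ⊗[𝕜] L)
      (TensorProduct.tensorTensorTensorComm 𝕜 L L L L (A ⊗ₜ[𝕜] B)))

/-- `I_R = [R₁₂, R₁₃] + [R₁₂, R₂₃] + [R₁₃, R₂₃]`. -/
def yangBaxter (R : L ⊗[𝕜] L) : L ⊗[𝕜] (L ⊗[𝕜] L) :=
  br12_13 R R + br12_23 R R + br13_23 R R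

/-- `a ⊗ b ⊗ c ↦ b ⊗ c ⊗ a`. -/
def rot : L ⊗[𝕜] (L ⊗[𝕜] L) →ₗ[𝕜] L ⊗[𝕜] (L ⊗[𝕜] L) :=
  (TensorProduct.assoc 𝕜 L L L).toLinearMap ∘ₗ (TensorProduct.comm 𝕜 L (L ⊗[𝕜] L)).toLinearMap

/-- The sum of a tensor and its two cyclic permutations. -/
def cycl (T : L ⊗[𝕜] (L ⊗[𝕜] L)) : L ⊗[𝕜] (L ⊗[𝕜] L) := T + rot T + rot (rot T)

/-- `[X ⊗ 1 + 1 ⊗ X, r]`. -/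
def adTensor (X : L) (r : L ⊗[𝕜] L) : L ⊗[𝕜] L :=
  TensorProduct.map (LieAlgebra.ad 𝕜 L X) LinearMap.id r +
    TensorProduct.map LinearMap.id (LieAlgebra.ad 𝕜 L X) r

end Tensors

/-- `r ∈ W ∧ W`, seen as the space of antisymmetric tensors in `W ⊗ W`. -/
def IsAntisymm {W : Type*} [AddCommGroup W] [Module 𝕜 W] (r : W ⊗[𝕜] W) : Prop :=
  TensorProduct.comm 𝕜 W W r = -r

/-! ### Poisson-Lie groups of coboundary type, their subgroups, duals and doubles -/

/-- `R ∈ 𝒢 ∧ 𝒢` solves the (modified) classical Yang-Baxter equation: `I_R` is `G`-invariant. -/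
structure IsConstantRMatrix {G : FDLieGroup 𝕜} (R : G.lie ⊗[𝕜] G.lie) : Prop where
  antisymm : IsAntisymm R
  invariant : ∀ g : G,
    TensorProduct.map (Ad g) (TensorProduct.map (Ad g) (Ad g)) (yangBaxter R) = yangBaxter R

/-- The bivector at `g` of the Poisson bracket `{g₁, g₂} = [g₁ g₂, R]` on `G`: the left translate
of `R` minus the right translate of `R`. -/
def poissonBivector {G : FDLieGroup 𝕜} (R : G.lie ⊗[𝕜] G.lie) (g : G) :
    TangentSpace 𝓘(𝕜, G.E) g ⊗[𝕜] TangentSpace 𝓘(𝕜, G.E) g :=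
  let l : G.lie →ₗ[𝕜] TangentSpace 𝓘(𝕜, G.E) g :=
    (show G.E →L[𝕜] G.E from mfderiv 𝓘(𝕜, G.E) 𝓘(𝕜, G.E) (fun x : G => g * x) 1).toLinearMap
  let r : G.lie →ₗ[𝕜] TangentSpace 𝓘(𝕜, G.E) g :=
    (show G.E →L[𝕜] G.E from mfderiv 𝓘(𝕜, G.E) 𝓘(𝕜, G.E) (fun x : G => x * g) 1).toLinearMap
  TensorProduct.map l l R - TensorProduct.map r r R

/-- `i` exhibits `K` as a Poisson-Lie subgroup of the Poisson-Lie group `G` defined by `R`: a Lie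
subgroup to which the Poisson bivector is tangent. -/
structure IsPoissonLieSubgroup {G K : FDLieGroup 𝕜} (R : G.lie ⊗[𝕜] G.lie) (i : K →* G) :
    Prop extends IsLieSubgroup i where
  tangent : ∀ k : K, poissonBivector R (i k) ∈
    LinearMap.range (TensorProduct.map
      (mfderiv 𝓘(𝕜, K.E) 𝓘(𝕜, G.E) i k).toLinearMap
      (mfderiv 𝓘(𝕜, K.E) 𝓘(𝕜, G.E) i k).toLinearMap)

/-- `Ks`, with the identification `e : Lie(K*) ≃ 𝒦*`, is a dual group of the Poisson-Lie subgroup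
`i : K → G`: the bracket of `𝒦*` is
`⟨[α, β], X⟩ = -⟨α ⊗ β, [X ⊗ 1 + 1 ⊗ X, R]⟩`, where on the right `α, β` are any extensions
to `𝒢` (the tensor lies in `𝒦 ∧ 𝒦`). The sign is the one for which
`{φ, f} = ⟨∇'φ, ∇f⟩`, together with the Poisson bracket of `G` for two functions on `G` and
`{f₁, f₂}(κ) = ⟪∇f₁, κ (∇'f₂) κ⁻¹⟫` for two functions on `K*`,
satisfies the Jacobi identity on `G × K*`. -/
def IsDualGroup {G K Ks : FDLieGroup 𝕜} (R : G.lie ⊗[𝕜] G.lie) (i : K →* G)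
    (e : Ks.lie ≃ₗ[𝕜] Module.Dual 𝕜 K.lie) : Prop :=
  ∀ (x y : Ks.lie) (α β : Module.Dual 𝕜 G.lie),
    α ∘ₗ dHom i = e x → β ∘ₗ dHom i = e y →
      ∀ X : K.lie, e ⁅x, y⁆ X =
        -(TensorProduct.dualDistrib 𝕜 G.lie G.lie (α ⊗ₜ[𝕜] β) (adTensor (dHom i X) R))

/-- `D` is a Drinfeld double Lie group of `K` and its dual group `Ks`: it contains both as Lie
subgroups, and `Lie(D) = 𝒦 ⊕ 𝒦*` with an invariant scalar product for which `𝒦` and `𝒦*` are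
isotropic and which pairs them canonically. -/
structure IsDrinfeldDouble {K Ks D : FDLieGroup 𝕜} (e : Ks.lie ≃ₗ[𝕜] Module.Dual 𝕜 K.lie)
    (jK : K →* D) (jKs : Ks →* D) : Prop where
  subgroup : IsLieSubgroup jK
  dual_subgroup : IsLieSubgroup jKs
  bijective : Function.Bijective ((dHom jK).coprod (dHom jKs))
  scalarProduct : ∃ B : LinearMap.BilinForm 𝕜 D.lie,
    (∀ u v, B u v = B v u) ∧
    (∀ u v w, B ⁅u, v⁆ w = B u ⁅v, w⁆) ∧
    (∀ X Y, B (dHom jK X) (dHom jK Y) = 0) ∧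
    (∀ x y, B (dHom jKs x) (dHom jKs y) = 0) ∧
    ∀ x X, B (dHom jKs x) (dHom jK X) = e x X

section Double

variable {G K Ks D : FDLieGroup 𝕜} {e : Ks.lie ≃ₗ[𝕜] Module.Dual 𝕜 K.lie}
  {jK : K →* D} {jKs : Ks →* D}

/-- `𝒦 ⊕ 𝒦* = Lie(D)`. -/
def IsDrinfeldDouble.equiv (hD : IsDrinfeldDouble e jK jKs) : (K.lie × Ks.lie) ≃ₗ[𝕜] D.lie :=
  LinearEquiv.ofBijective _ hD.bijective

/-- `X ↦ (κ X κ⁻¹)_𝒦` for `κ ∈ K*`, computed in the double. -/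
def conjK (hD : IsDrinfeldDouble e jK jKs) (κ : Ks) : K.lie →ₗ[𝕜] K.lie :=
  LinearMap.fst 𝕜 K.lie Ks.lie ∘ₗ hD.equiv.symm.toLinearMap ∘ₗ Ad (jKs κ) ∘ₗ dHom jK

/-- `X ↦ (κ X κ⁻¹)_{𝒦*}` for `κ ∈ K*`, computed in the double. -/
def conjKs (hD : IsDrinfeldDouble e jK jKs) (κ : Ks) : K.lie →ₗ[𝕜] Ks.lie :=
  LinearMap.snd 𝕜 K.lie Ks.lie ∘ₗ hD.equiv.symm.toLinearMap ∘ₗ Ad (jKs κ) ∘ₗ dHom jK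

/-- The infinitesimal left dressing action `dress_X κ = κ (κ⁻¹ X κ)_{𝒦*}` applied to a
vector-valued function on `K*`. -/
def dress {V : Type*} [AddCommGroup V] [Module 𝕜 V] [Module.Finite 𝕜 V]
    (hD : IsDrinfeldDouble e jK jKs) (X : K.lie) (F : Ks → V) (κ : Ks) : V :=
  rightDerivVec F (conjKs hD κ⁻¹ X) κ

/-- `r : U → 𝒢 ∧ 𝒢` (for `U ⊆ K*` open) is a triangular Poisson-Lie dynamical `r`-matrix for
`K ⊆ G`, i.e. it is smooth, infinitesimally equivariant, and satisfies the Poisson-Lie classical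
dynamical Yang-Baxter equation with right-hand side `I_R`. -/
structure IsTriangularDynamicalRMatrix (R : G.lie ⊗[𝕜] G.lie) (i : K →* G)
    (hD : IsDrinfeldDouble e jK jKs) (U : Set Ks) (r : Ks → G.lie ⊗[𝕜] G.lie) : Prop where
  smooth : SmoothOn r U
  antisymm : ∀ κ ∈ U, IsAntisymm (r κ)
  equivariant : ∀ κ ∈ U, ∀ X : K.lie, dress hD X r κ = adTensor (dHom i X) (r κ)
  cdybe : ∀ κ ∈ U,
    cycl (br12_23 (R + r κ) (R + r κ) +
      ∑ a, dHom i (Module.finBasis 𝕜 K.lie a) ⊗ₜ[𝕜]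
        leftDerivVec r (e.symm ((Module.finBasis 𝕜 K.lie).coord a)) κ) = yangBaxter R

/-- The conditions on a decomposition `𝒦 = ℋ + ℳ`, with `ℋ* = ℳ^⊥` and
`ℳ* = ℋ^⊥` in `𝒦*`. -/
structure IsReductiveDecomposition (e : Ks.lie ≃ₗ[𝕜] Module.Dual 𝕜 K.lie)
    (h M : Submodule 𝕜 K.lie) : Prop where
  isCompl : IsCompl M h
  subalgebra : ∀ X ∈ h, ∀ Y ∈ h, ⁅X, Y⁆ ∈ h
  dual_subalgebra : ∀ x y : Ks.lie, e x ∈ M.dualAnnihilator → e y ∈ M.dualAnnihilator →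
    e ⁅x, y⁆ ∈ M.dualAnnihilator
  perp_ideal : ∀ x y : Ks.lie, e y ∈ h.dualAnnihilator → e ⁅x, y⁆ ∈ h.dualAnnihilator
  reductive : ∀ X ∈ h, ∀ Y ∈ M, ⁅X, Y⁆ ∈ M

variable {h M : Submodule 𝕜 K.lie}

/-- `u ↦ (κ u κ⁻¹)_ℳ` on `ℳ`, the projection being along `ℋ`. -/
def conjM (hD : IsDrinfeldDouble e jK jKs) (hM : IsReductiveDecomposition e h M) (κ : Ks) :
    M →ₗ[𝕜] M :=
  M.projectionOnto h hM.isCompl ∘ₗ conjK hD κ ∘ₗ M.subtype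

/-- The bilinear form `(u, v) ↦ ⟪(κ u κ⁻¹)_ℳ, κ v κ⁻¹⟫` on `ℳ`. -/
def formM (hD : IsDrinfeldDouble e jK jKs) (hM : IsReductiveDecomposition e h M) (κ : Ks) :
    M →ₗ[𝕜] M →ₗ[𝕜] 𝕜 :=
  (Module.Dual.eval 𝕜 K.lie).compl₁₂ (M.subtype ∘ₗ conjM hD hM κ)
    (e.toLinearMap ∘ₗ conjKs hD κ ∘ₗ M.subtype)

variable {ι : Type*} [Fintype ι] [DecidableEq ι]

/-- `Cⁱʲ(κ) = ⟪(κ Mⁱ κ⁻¹)_ℳ, κ Mʲ κ⁻¹⟫` for a basis `Mⁱ` of `ℳ`. -/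
def constraintMatrix (hD : IsDrinfeldDouble e jK jKs) (hM : IsReductiveDecomposition e h M)
    (b : Module.Basis ι 𝕜 M) (κ : Ks) : Matrix ι ι 𝕜 :=
  Matrix.of fun m n => formM hD hM κ (b m) (b n)

/-- `ρ(κ) = ∑ (C⁻¹(κ))ᵢⱼ (κ Mⁱ κ⁻¹)_ℳ ⊗ (κ Mʲ κ⁻¹)_ℳ ∈ ℳ ⊗ ℳ`. -/
def rhoM (hD : IsDrinfeldDouble e jK jKs) (hM : IsReductiveDecomposition e h M)
    (b : Module.Basis ι 𝕜 M) (κ : Ks) : M ⊗[𝕜] M :=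
  ∑ m, ∑ n, (constraintMatrix hD hM b κ)⁻¹ m n •
    (conjM hD hM κ (b m) ⊗ₜ[𝕜] conjM hD hM κ (b n))

/-- `ρ(κ)`, seen in `𝒢 ⊗ 𝒢`. -/
def rho (i : K →* G) (hD : IsDrinfeldDouble e jK jKs) (hM : IsReductiveDecomposition e h M)
    (b : Module.Basis ι 𝕜 M) (κ : Ks) : G.lie ⊗[𝕜] G.lie :=
  TensorProduct.map (dHom i ∘ₗ M.subtype) (dHom i ∘ₗ M.subtype) (rhoM hD hM b κ)

/-- The property characterizing the value at `κ` of the Enriquez-Etingof-Marshall `r`-matrix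
`σ = ∑ Mⁱ ⊗ Nᵢ = -∑ Nᵢ ⊗ Mⁱ`: for all `u, v ∈ ℳ`,
`⟪(κ⁻¹uκ)_ℳ, κ⁻¹vκ⟫ = ∑ ⟪(κ⁻¹uκ)_ℳ, κ⁻¹Mⁱκ⟫ ⟪(κ⁻¹vκ)_ℳ, κ⁻¹Nᵢκ⟫`. -/
structure IsEEMSigma (hD : IsDrinfeldDouble e jK jKs) (hM : IsReductiveDecomposition e h M)
    (κ : Ks) (s : M ⊗[𝕜] M) : Prop where
  antisymm : IsAntisymm s
  identity : ∀ u v : M, formM hD hM κ⁻¹ u v =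
    TensorProduct.dualDistrib 𝕜 M M (formM hD hM κ⁻¹ u ⊗ₜ[𝕜] formM hD hM κ⁻¹ v) s

end Double

end PoissonLie

end

/-!
Fix `λ ∈ H*` and write `y_ℳ*` for the component in `ℳ* = ℋ^⊥` of `y ∈ 𝒦* = ℋ* ⊕ ℳ*`. The idea is
that the graph `{ρ^♯ y + y_ℳ*}` of `ρ(λ)`, where `ρ^♯ y` is the contraction of `ρ(λ)` with `y` in
its second factor, is the subspace `λ ℳ λ⁻¹` of the double `𝒦 ⊕ 𝒦*` (`IsDualSubgroup.Ad_rhoSol`).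
For this, the double of `H` is embedded in the double of `K` compatibly with the action of `ℋ*`: the
invariance of the scalar products determines the mixed brackets, which uses that `ℳ` is
`ℋ`-invariant and that `ℋ^⊥` is an ideal. As `H*` is connected, the embedding commutes with `H*`
(`IsDualSubgroup.doubleEmb_Ad`). Hence `λ ℳ λ⁻¹` is orthogonal to `ℋ ⊕ ℋ*`, so that it lies in
`ℳ ⊕ ℳ*`, and invertibility of `C(λ)` makes it a graph over `ℳ*`.

Everything else is read off from the graph, which is contained in the isotropic subalgebra
`λ 𝒦 λ⁻¹`. Isotropy gives the antisymmetry of `ρ`; applying `λ⁻¹` gives the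
Enriquez-Etingof-Marshall identity, whose bilinear form is the inverse of `ρ`
(`IsDualSubgroup.formM_inv_rhoMap`), hence also uniqueness. The derivative of `ρ` along `x ∈ ℋ*` is
`⟪ρ^♯ y + y_ℳ*, [x, ρ^♯ z + z_ℳ*]⟫` (`IsDualSubgroup.leftDeriv_rhoMap`): the graph moves by the
adjoint action, and isotropy kills the reparametrization of `ℳ`. Combined with the isotropy and the
bracket-closedness of `λ 𝒦 λ⁻¹`, this yields equivariance (`IsDualSubgroup.dress_rho`) and, through
`⟪[u, v], w⟫ = 0` on the graph, the part of the dynamical Yang-Baxter equation that does not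
involve `r` (`IsDualSubgroup.cyclic_sum_rhoMap`).

Finally, the equation for `r + ρ` on `H*` is compared with that for `r` on `K*`. The latter
has in addition the derivatives of `r` along `ℳ*`. Since `-y_ℳ*` is the value at `λ` of the
right-translated dressing vector field of `ρ^♯ y` (`IsDualSubgroup.Ad_conjKs_rhoMap`), the
equivariance of `r` turns them into the commutators of `ρ` and `r`, which are the cross terms of the
quadratic part (`IsDualSubgroup.isTriangularDynamicalRMatrix_add_rho`).

The required Lie theory (smoothness of the adjoint action, its differential, the compatibility of
homomorphisms with brackets, and the invariance under a connected group of infinitesimally invariant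
forms) is derived from the multiplication in the chart at `1`.
-/

section

open Set Filter Topology

noncomputable section

namespace PoissonLie

variable {𝕜 : Type*} [RCLike 𝕜]

/-! ### The Lie bracket in a chart -/

lemma isTopologicalGroup (A : FDLieGroup 𝕜) : IsTopologicalGroup A :=
  topologicalGroup_of_lieGroup 𝓘(𝕜, A.E) ∞

variable {A B C : FDLieGroup 𝕜} {F : Type*} [NormedAddCommGroup F] [NormedSpace 𝕜 F]

/-- The differential at `a` of a map between Lie groups, as a map between the model spaces. -/
def gder (f : A → B) (a : A) : A.E →L[𝕜] B.E := mfderiv 𝓘(𝕜, A.E) 𝓘(𝕜, B.E) f a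

/-- The differential at `a` of a map from a Lie group to a normed space, as a map from the model
space. -/
def vder (f : A → F) (a : A) : A.E →L[𝕜] F := mfderiv 𝓘(𝕜, A.E) 𝓘(𝕜, F) f a

lemma gder_comp {f : B → C} {g : A → B} {a : A}
    (hf : MDifferentiableAt 𝓘(𝕜, B.E) 𝓘(𝕜, C.E) f (g a))
    (hg : MDifferentiableAt 𝓘(𝕜, A.E) 𝓘(𝕜, B.E) g a) :
    gder (f ∘ g) a = (gder f (g a)).comp (gder g a) := mfderiv_comp a hf hg

lemma vder_comp {f : B → F} {g : A → B} {a : A}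
    (hf : MDifferentiableAt 𝓘(𝕜, B.E) 𝓘(𝕜, F) f (g a))
    (hg : MDifferentiableAt 𝓘(𝕜, A.E) 𝓘(𝕜, B.E) g a) :
    vder (f ∘ g) a = (vder f (g a)).comp (gder g a) := mfderiv_comp a hf hg

lemma vder_eq_fderiv_chart {f : A → F} {a : A} (hf : MDifferentiableAt 𝓘(𝕜, A.E) 𝓘(𝕜, F) f a) :
    vder f a = fderiv 𝕜 (f ∘ (extChartAt 𝓘(𝕜, A.E) a).symm) (extChartAt 𝓘(𝕜, A.E) a a) := by
  have h : vder f a = fderivWithin 𝕜 (writtenInExtChartAt 𝓘(𝕜, A.E) 𝓘(𝕜, F) a f)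
      (range 𝓘(𝕜, A.E)) (extChartAt 𝓘(𝕜, A.E) a a) := if_pos hf
  rw [h, writtenInExtChartAt, extChartAt_model_space_eq_id]
  simp [Function.comp_def]

lemma fderiv_extChartAt_comp_symm (A : FDLieGroup 𝕜) (a : A) :
    fderiv 𝕜 (extChartAt 𝓘(𝕜, A.E) a ∘ (extChartAt 𝓘(𝕜, A.E) a).symm)
      (extChartAt 𝓘(𝕜, A.E) a a) = ContinuousLinearMap.id 𝕜 A.E := by
  have : (extChartAt 𝓘(𝕜, A.E) a ∘ (extChartAt 𝓘(𝕜, A.E) a).symm)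
      =ᶠ[𝓝 (extChartAt 𝓘(𝕜, A.E) a a)] id := by
    filter_upwards [extChartAt_target_mem_nhds (I := 𝓘(𝕜, A.E)) a] with p hp
    exact (extChartAt 𝓘(𝕜, A.E) a).right_inv hp
  rw [this.fderiv_eq, fderiv_id]

lemma vder_extChartAt_self (A : FDLieGroup 𝕜) (a : A) :
    vder (extChartAt 𝓘(𝕜, A.E) a) a = ContinuousLinearMap.id 𝕜 A.E := by
  rw [vder_eq_fderiv_chart
    (mdifferentiableAt_extChartAt (mem_chart_source A.E a)), fderiv_extChartAt_comp_symm]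

/-- The chart at `1`. -/
def chart (A : FDLieGroup 𝕜) : PartialEquiv A A.E := extChartAt 𝓘(𝕜, A.E) (1 : A)

/-- The image of `1` in the chart at `1`. -/
def chartOne (A : FDLieGroup 𝕜) : A.E := chart A 1

/-- The multiplication read in the chart at `1`. -/
def chartMul (A : FDLieGroup 𝕜) (z : A.E × A.E) : A.E :=
  chart A ((chart A).symm z.1 * (chart A).symm z.2)

lemma one_mem_chart_source : (1 : A) ∈ (chart A).source := mem_extChartAt_source (1 : A)

lemma chart_target_mem_nhds : (chart A).target ∈ 𝓝 (chartOne A) :=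
  extChartAt_target_mem_nhds (1 : A)

lemma chart_symm_chartOne : (chart A).symm (chartOne A) = 1 :=
  (chart A).left_inv one_mem_chart_source

lemma contMDiffAt_chart_symm {p : A.E} (hp : p ∈ (chart A).target) :
    ContMDiffAt 𝓘(𝕜, A.E) 𝓘(𝕜, A.E) ∞ (chart A).symm p :=
  (contMDiffOn_extChartAt_symm (1 : A)).contMDiffAt
    ((isOpen_extChartAt_target (1 : A)).mem_nhds hp)

lemma contMDiffAt_chart {a : A} (ha : a ∈ (chart A).source) :
    ContMDiffAt 𝓘(𝕜, A.E) 𝓘(𝕜, A.E) ∞ (chart A) a :=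
  contMDiffAt_extChartAt' (by simpa [chart] using ha)

lemma contDiffAt_chartMul (A : FDLieGroup 𝕜) :
    ContDiffAt 𝕜 ∞ (chartMul A) (chartOne A, chartOne A) := by
  rw [← contMDiffAt_iff_contDiffAt]
  have h1 : ContMDiffAt 𝓘(𝕜, A.E) 𝓘(𝕜, A.E) ∞ (chart A).symm (chartOne A) :=
    contMDiffAt_chart_symm (mem_of_mem_nhds chart_target_mem_nhds)
  have hfst : ContMDiffAt 𝓘(𝕜, A.E × A.E) 𝓘(𝕜, A.E) ∞ (fun z : A.E × A.E => (chart A).symm z.1)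
      (chartOne A, chartOne A) :=
    ContMDiffAt.comp (I' := 𝓘(𝕜, A.E)) (chartOne A, chartOne A) h1
      contDiff_fst.contMDiff.contMDiffAt
  have hsnd : ContMDiffAt 𝓘(𝕜, A.E × A.E) 𝓘(𝕜, A.E) ∞ (fun z : A.E × A.E => (chart A).symm z.2)
      (chartOne A, chartOne A) :=
    ContMDiffAt.comp (I' := 𝓘(𝕜, A.E)) (chartOne A, chartOne A) h1
      contDiff_snd.contMDiff.contMDiffAt
  refine ContMDiffAt.comp (I' := 𝓘(𝕜, A.E)) (chartOne A, chartOne A) ?_ (hfst.mul hsnd)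
  apply contMDiffAt_chart
  simp [chart_symm_chartOne, one_mem_chart_source]

lemma chartMul_one_left (A : FDLieGroup 𝕜) :
    (fun q => chartMul A (chartOne A, q)) =ᶠ[𝓝 (chartOne A)] id := by
  filter_upwards [chart_target_mem_nhds] with p hp
  simp [chartMul, chart_symm_chartOne, (chart A).right_inv hp]

lemma chartMul_one_right (A : FDLieGroup 𝕜) :
    (fun q => chartMul A (q, chartOne A)) =ᶠ[𝓝 (chartOne A)] id := by
  filter_upwards [chart_target_mem_nhds] with p hp
  simp [chartMul, chart_symm_chartOne, (chart A).right_inv hp]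

lemma eventually_differentiableAt_chartMul (A : FDLieGroup 𝕜) :
    ∀ᶠ z in 𝓝 (chartOne A, chartOne A), DifferentiableAt 𝕜 (chartMul A) z := by
  filter_upwards [((contDiffAt_chartMul A).of_le (m := 1) (by simp)).eventually (by simp)]
    with p hp
  exact hp.differentiableAt (by simp)

lemma mdifferentiableAt_mul_left (g a : A) :
    MDifferentiableAt 𝓘(𝕜, A.E) 𝓘(𝕜, A.E) (fun x : A => g * x) a :=
  (contMDiff_mul_left (n := ∞)).contMDiffAt.mdifferentiableAt (by simp)

lemma mdifferentiableAt_mul_right (g a : A) :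
    MDifferentiableAt 𝓘(𝕜, A.E) 𝓘(𝕜, A.E) (fun x : A => x * g) a :=
  (contMDiff_mul_right (n := ∞)).contMDiffAt.mdifferentiableAt (by simp)

lemma mdifferentiableAt_conj (g a : A) :
    MDifferentiableAt 𝓘(𝕜, A.E) 𝓘(𝕜, A.E) (fun x : A => g * x * g⁻¹) a :=
  (mdifferentiableAt_mul_right g⁻¹ (g * a)).comp a (mdifferentiableAt_mul_left g a)

lemma mdifferentiableAt_chart {a : A} (ha : a ∈ (chart A).source) :
    MDifferentiableAt 𝓘(𝕜, A.E) 𝓘(𝕜, A.E) (chart A) a :=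
  (contMDiffAt_chart ha).mdifferentiableAt (by simp)

lemma vder_chart_comp_mul_left {p : A.E} (hp : p ∈ (chart A).target)
    (hd : DifferentiableAt 𝕜 (chartMul A) (p, chartOne A)) (v : A.E) :
    vder (chart A ∘ fun x : A => (chart A).symm p * x) 1 v =
      fderiv 𝕜 (chartMul A) (p, chartOne A) (0, v) := by
  have hφd : MDifferentiableAt 𝓘(𝕜, A.E) 𝓘(𝕜, A.E) (chart A) ((chart A).symm p * 1) :=
    mdifferentiableAt_chart (by rw [mul_one]; exact (chart A).map_target hp)
  rw [vder_eq_fderiv_chart (hφd.comp (1 : A) (mdifferentiableAt_mul_left _ 1))]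
  change fderiv 𝕜 (chartMul A ∘ fun q => (p, q)) (chartOne A) v = _
  rw [fderiv_comp _ hd (by fun_prop),
    (hasFDerivAt_prodMk_right p (chartOne A)).fderiv (𝕜 := 𝕜)]
  simp

lemma vder_chart_comp_mul_right {p : A.E} (hp : p ∈ (chart A).target)
    (hd : DifferentiableAt 𝕜 (chartMul A) (chartOne A, p)) (v : A.E) :
    vder (chart A ∘ fun x : A => x * (chart A).symm p) 1 v =
      fderiv 𝕜 (chartMul A) (chartOne A, p) (v, 0) := by
  have hφd : MDifferentiableAt 𝓘(𝕜, A.E) 𝓘(𝕜, A.E) (chart A) (1 * (chart A).symm p) :=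
    mdifferentiableAt_chart (by rw [one_mul]; exact (chart A).map_target hp)
  rw [vder_eq_fderiv_chart (hφd.comp (1 : A) (mdifferentiableAt_mul_right _ 1))]
  change fderiv 𝕜 (chartMul A ∘ fun q => (q, p)) (chartOne A) v = _
  rw [fderiv_comp (f := fun q => (q, p)) (chartOne A) hd (by fun_prop),
    (hasFDerivAt_prodMk_left (chartOne A) p).fderiv (𝕜 := 𝕜)]
  simp

lemma eventually_differentiableAt_chartMul_left (A : FDLieGroup 𝕜) :
    ∀ᶠ p in 𝓝 (chartOne A), DifferentiableAt 𝕜 (chartMul A) (p, chartOne A) :=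
  (show ContinuousAt (fun p : A.E => (p, chartOne A)) (chartOne A) by fun_prop).eventually
    (eventually_differentiableAt_chartMul A)

lemma eventually_differentiableAt_chartMul_right (A : FDLieGroup 𝕜) :
    ∀ᶠ p in 𝓝 (chartOne A), DifferentiableAt 𝕜 (chartMul A) (chartOne A, p) :=
  (show ContinuousAt (fun p : A.E => (chartOne A, p)) (chartOne A) by fun_prop).eventually
    (eventually_differentiableAt_chartMul A)

/-- The left-invariant vector field through `v` at `1`, read in the chart at `1`. -/
def invField (v p : A.E) : A.E :=
  VectorField.mpullbackWithin 𝓘(𝕜, A.E) 𝓘(𝕜, A.E) (chart A).symm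
    (mulInvariantVectorField v) (range 𝓘(𝕜, A.E)) p

lemma invField_eventuallyEq (v : A.E) :
    invField v =ᶠ[𝓝 (chartOne A)] fun p => fderiv 𝕜 (chartMul A) (p, chartOne A) (0, v) := by
  filter_upwards [chart_target_mem_nhds, eventually_differentiableAt_chartMul_left A] with p hp hdp
  have hinv : (mfderivWithin 𝓘(𝕜, A.E) 𝓘(𝕜, A.E) (chart A).symm (range 𝓘(𝕜, A.E)) p).inverse =
      mfderiv 𝓘(𝕜, A.E) 𝓘(𝕜, A.E) (chart A) ((chart A).symm p) := by
    apply ContinuousLinearMap.inverse_eq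
    · exact mfderivWithin_extChartAt_symm_comp_mfderiv_extChartAt hp
    · exact mfderiv_extChartAt_comp_mfderivWithin_extChartAt_symm hp
  have hφd : MDifferentiableAt 𝓘(𝕜, A.E) 𝓘(𝕜, A.E) (chart A) ((chart A).symm p * 1) :=
    mdifferentiableAt_chart (by rw [mul_one]; exact (chart A).map_target hp)
  have hc := vder_comp hφd (mdifferentiableAt_mul_left ((chart A).symm p) 1)
  calc invField v p = vder (chart A) ((chart A).symm p)
        (gder (fun x : A => (chart A).symm p * x) 1 v) := by
        rw [invField, VectorField.mpullbackWithin_apply, hinv]; rfl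
    _ = vder (chart A) ((chart A).symm p * 1) (gder (fun x : A => (chart A).symm p * x) 1 v) := by
        rw [mul_one]
    _ = vder (chart A ∘ fun x : A => (chart A).symm p * x) 1 v := by rw [hc]; rfl
    _ = _ := vder_chart_comp_mul_left hp hdp v

/-- The Lie bracket, on the model space. -/
def lieE (v w : A.E) : A.E := @Bracket.bracket A.lie A.lie _ v w

lemma lieE_eq_lieBracket (v w : A.E) :
    lieE v w = VectorField.lieBracket 𝕜 (fun p => fderiv 𝕜 (chartMul A) (p, chartOne A) (0, v))
      (fun p => fderiv 𝕜 (chartMul A) (p, chartOne A) (0, w)) (chartOne A) := by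
  have h1 : lieE v w = (vder (chart A) 1).inverse
      (VectorField.lieBracketWithin 𝕜 (invField v) (invField w)
        (univ ∩ range 𝓘(𝕜, A.E)) (chartOne A)) := rfl
  have h2 : vder (chart A) 1 = ContinuousLinearMap.id 𝕜 A.E := vder_extChartAt_self A 1
  rw [h1, h2, modelWithCornersSelf_coe, range_id, univ_inter, ContinuousLinearMap.inverse_id,
    VectorField.lieBracketWithin_univ, ContinuousLinearMap.id_apply]
  exact Filter.EventuallyEq.lieBracket_vectorField_eq (invField_eventuallyEq v)
    (invField_eventuallyEq w)

lemma differentiableAt_fderiv_chartMul (A : FDLieGroup 𝕜) :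
    DifferentiableAt 𝕜 (fderiv 𝕜 (chartMul A)) (chartOne A, chartOne A) :=
  ((contDiffAt_chartMul A).fderiv_right (m := ∞) (by simp)).differentiableAt (by simp)

lemma hasFDerivAt_fderiv_chartMul_left (A : FDLieGroup 𝕜) :
    HasFDerivAt (fun p => fderiv 𝕜 (chartMul A) (p, chartOne A))
      ((fderiv 𝕜 (fderiv 𝕜 (chartMul A)) (chartOne A, chartOne A)).comp
        (ContinuousLinearMap.inl 𝕜 A.E A.E)) (chartOne A) :=
  HasFDerivAt.comp (f := fun p => (p, chartOne A)) (chartOne A)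
    (differentiableAt_fderiv_chartMul A).hasFDerivAt (hasFDerivAt_prodMk_left _ _)

lemma hasFDerivAt_fderiv_chartMul_right (A : FDLieGroup 𝕜) :
    HasFDerivAt (fun p => fderiv 𝕜 (chartMul A) (chartOne A, p))
      ((fderiv 𝕜 (fderiv 𝕜 (chartMul A)) (chartOne A, chartOne A)).comp
        (ContinuousLinearMap.inr 𝕜 A.E A.E)) (chartOne A) :=
  HasFDerivAt.comp (f := fun p => (chartOne A, p)) (chartOne A)
    (differentiableAt_fderiv_chartMul A).hasFDerivAt (hasFDerivAt_prodMk_right _ _)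

lemma fderiv_chartMul_inr (u : A.E) :
    fderiv 𝕜 (chartMul A) (chartOne A, chartOne A) (0, u) = u := by
  have h := ((contDiffAt_chartMul A).differentiableAt (by simp)).hasFDerivAt.comp (chartOne A)
    (hasFDerivAt_prodMk_right (𝕜 := 𝕜) (chartOne A) (chartOne A))
  have h' := (chartMul_one_left A).fderiv_eq (𝕜 := 𝕜)
  rw [show (fun q => chartMul A (chartOne A, q)) = chartMul A ∘ (fun q => (chartOne A, q)) from rfl,
    h.fderiv, fderiv_id] at h'
  simpa using congrArg (fun L => L u) h'

lemma fderiv_chartMul_inl (u : A.E) :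
    fderiv 𝕜 (chartMul A) (chartOne A, chartOne A) (u, 0) = u := by
  have h := HasFDerivAt.comp (f := fun p => (p, chartOne A)) (chartOne A)
    ((contDiffAt_chartMul A).differentiableAt (by simp)).hasFDerivAt
    (hasFDerivAt_prodMk_left (𝕜 := 𝕜) (chartOne A) (chartOne A))
  have h' := (chartMul_one_right A).fderiv_eq (𝕜 := 𝕜)
  rw [show (fun q => chartMul A (q, chartOne A)) = chartMul A ∘ (fun q => (q, chartOne A)) from rfl,
    h.fderiv, fderiv_id] at h'
  simpa using congrArg (fun L => L u) h'

/-- In the chart at `1`, the bracket is the antisymmetrized mixed second derivative of the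
multiplication. -/
lemma lieE_eq (v w : A.E) :
    lieE v w = fderiv 𝕜 (fderiv 𝕜 (chartMul A)) (chartOne A, chartOne A) (v, 0) (0, w) -
      fderiv 𝕜 (fderiv 𝕜 (chartMul A)) (chartOne A, chartOne A) (w, 0) (0, v) := by
  have key : ∀ u x : A.E, fderiv 𝕜 (fun p => fderiv 𝕜 (chartMul A) (p, chartOne A) (0, u))
      (chartOne A) x =
      fderiv 𝕜 (fderiv 𝕜 (chartMul A)) (chartOne A, chartOne A) (x, 0) (0, u) := by
    intro u x
    rw [((hasFDerivAt_fderiv_chartMul_left A).clm_apply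
      (hasFDerivAt_const ((0, u) : A.E × A.E) (chartOne A))).fderiv]
    simp
  rw [lieE_eq_lieBracket, VectorField.lieBracket, key, key, fderiv_chartMul_inr,
    fderiv_chartMul_inr]

/-! ### The adjoint action -/

/-- The adjoint action, on the model space. -/
def AdE (g : A) : A.E →L[𝕜] A.E := gder (fun x : A => g * x * g⁻¹) 1

lemma AdE_one : AdE (1 : A) = ContinuousLinearMap.id 𝕜 A.E := by
  have : (fun x : A => 1 * x * 1⁻¹) = id := by ext; simp
  rw [AdE, this]
  exact mfderiv_id

lemma AdE_mul (g h : A) : AdE (g * h) = (AdE g).comp (AdE h) := by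
  have : (fun x : A => g * h * x * (g * h)⁻¹) =
      (fun x => g * x * g⁻¹) ∘ (fun x => h * x * h⁻¹) := by ext; simp [mul_assoc]
  rw [AdE, this, gder_comp (mdifferentiableAt_conj _ _) (mdifferentiableAt_conj _ _)]
  simp only [mul_one, mul_inv_cancel]
  rfl

/-- Left translation is conjugation followed by right translation; differentiated at `1`, in the
chart. -/
lemma fderiv_chartMul_AdE (A : FDLieGroup 𝕜) : ∀ᶠ p in 𝓝 (chartOne A), ∀ w : A.E,
    fderiv 𝕜 (chartMul A) (chartOne A, p) (AdE ((chart A).symm p) w, 0) =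
      fderiv 𝕜 (chartMul A) (p, chartOne A) (0, w) := by
  filter_upwards [chart_target_mem_nhds, eventually_differentiableAt_chartMul_left A,
    eventually_differentiableAt_chartMul_right A] with p hp hl hr w
  set g := (chart A).symm p with hg
  rw [← vder_chart_comp_mul_left hp hl, ← vder_chart_comp_mul_right hp hr]
  have h : (chart A ∘ fun x : A => g * x) =
      (chart A ∘ fun x : A => x * g) ∘ (fun x => g * x * g⁻¹) := by
    ext; simp
  have hφd : MDifferentiableAt 𝓘(𝕜, A.E) 𝓘(𝕜, A.E) (chart A) ((g * 1 * g⁻¹) * g) :=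
    mdifferentiableAt_chart (by simpa [hg] using (chart A).map_target hp)
  have hc := vder_comp (f := chart A ∘ fun x : A => x * g) (g := fun x : A => g * x * g⁻¹) (a := 1)
    (hφd.comp (g * 1 * g⁻¹) (mdifferentiableAt_mul_right g (g * 1 * g⁻¹)))
    (mdifferentiableAt_conj g 1)
  simp only [mul_one, mul_inv_cancel] at hc
  rw [← hg, h, hc]
  rfl

/-- Near `1`, the adjoint action is `L(p)⁻¹ R(p)`, where `L(p)` and `R(p)` are the partial
differentials of the multiplication at `(1, p)` and `(p, 1)`. -/
lemma contDiffAt_AdE_chart (A : FDLieGroup 𝕜) :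
    ContDiffAt 𝕜 ∞ (fun p => AdE ((chart A).symm p)) (chartOne A) := by
  let L : A.E → A.E →L[𝕜] A.E := fun p =>
    (fderiv 𝕜 (chartMul A) (chartOne A, p)).comp (ContinuousLinearMap.inl 𝕜 A.E A.E)
  let R : A.E → A.E →L[𝕜] A.E := fun p =>
    (fderiv 𝕜 (chartMul A) (p, chartOne A)).comp (ContinuousLinearMap.inr 𝕜 A.E A.E)
  have hμ := (contDiffAt_chartMul A).fderiv_right (m := ∞) (by simp)
  have hL : ContDiffAt 𝕜 ∞ L (chartOne A) :=
    ContDiffAt.clm_comp (hμ.comp (chartOne A) (contDiffAt_const.prodMk contDiffAt_id))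
      contDiffAt_const
  have hR : ContDiffAt 𝕜 ∞ R (chartOne A) :=
    ContDiffAt.clm_comp (ContDiffAt.comp (f := fun p => (p, chartOne A)) (chartOne A) hμ
      (contDiffAt_id.prodMk contDiffAt_const)) contDiffAt_const
  have hL1 : L (chartOne A) = (ContinuousLinearEquiv.refl 𝕜 A.E : A.E →L[𝕜] A.E) := by
    ext u; simp [L, fderiv_chartMul_inl]
  have hinv : ContDiffAt 𝕜 ∞ (fun p => (L p).inverse) (chartOne A) := by
    refine ContDiffAt.comp (chartOne A) (g := ContinuousLinearMap.inverse) ?_ hL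
    rw [hL1]
    exact contDiffAt_map_inverse _
  have hev : ∀ᶠ p in 𝓝 (chartOne A), L p ∈ range ((↑) : (A.E ≃L[𝕜] A.E) → A.E →L[𝕜] A.E) := by
    refine hL.continuousAt.eventually ?_
    rw [hL1]
    exact ContinuousLinearEquiv.nhds _
  refine (hinv.clm_comp hR).congr_of_eventuallyEq ?_
  filter_upwards [hev, fderiv_chartMul_AdE A] with p ⟨T, hT⟩ hp
  ext w
  have h : L p (AdE ((chart A).symm p) w) = R p w := by simpa [L, R] using hp w
  rw [ContinuousLinearMap.comp_apply, ← h, ← hT, ContinuousLinearMap.inverse_equiv]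
  simp

/-- The adjoint action is smooth: near `1` by the formula in the chart, and everywhere because it is
multiplicative. -/
lemma contMDiff_AdE (A : FDLieGroup 𝕜) :
    ContMDiff 𝓘(𝕜, A.E) 𝓘(𝕜, A.E →L[𝕜] A.E) ∞ (AdE : A → A.E →L[𝕜] A.E) := by
  have h1 : ContMDiffAt 𝓘(𝕜, A.E) 𝓘(𝕜, A.E →L[𝕜] A.E) ∞ (AdE : A → A.E →L[𝕜] A.E) 1 := by
    have := ContMDiffAt.comp (1 : A) (contDiffAt_AdE_chart A).contMDiffAt
      (contMDiffAt_chart one_mem_chart_source)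
    refine this.congr_of_eventuallyEq ?_
    filter_upwards [extChartAt_source_mem_nhds (I := 𝓘(𝕜, A.E)) (1 : A)] with a ha
    exact congrArg AdE ((chart A).left_inv ha).symm
  intro g
  have h2 : (AdE : A → A.E →L[𝕜] A.E) = fun a => (AdE g).comp (AdE (g⁻¹ * a)) := by
    ext1 a; rw [← AdE_mul, mul_inv_cancel_left]
  rw [h2]
  refine ContMDiffAt.clm_comp contMDiffAt_const ?_
  refine ContMDiffAt.comp (I' := 𝓘(𝕜, A.E)) (g := AdE) (f := fun a => g⁻¹ * a) g ?_
    (contMDiff_mul_left (n := ∞)).contMDiffAt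
  rwa [inv_mul_cancel]

/-- The differential at `1` of the adjoint action is the Lie bracket. -/
lemma vder_AdE_one (v w : A.E) : vder (AdE : A → A.E →L[𝕜] A.E) 1 v w = lieE v w := by
  have hd := (contDiffAt_AdE_chart A).differentiableAt (by simp)
  rw [vder_eq_fderiv_chart ((contMDiff_AdE A).contMDiffAt.mdifferentiableAt (by simp))]
  change fderiv 𝕜 (fun p => AdE ((chart A).symm p)) (chartOne A) v w = _
  set S := fderiv 𝕜 (fun p => AdE ((chart A).symm p)) (chartOne A)
  have e1 := ((hasFDerivAt_fderiv_chartMul_left A).clm_apply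
      (hasFDerivAt_const ((0, w) : A.E × A.E) (chartOne A)))
  have e2 := ((hasFDerivAt_fderiv_chartMul_right A).clm_apply
      ((hd.hasFDerivAt.clm_apply (hasFDerivAt_const w (chartOne A))).prodMk
        (hasFDerivAt_const (0 : A.E) (chartOne A))))
  have h := (show (fun p => fderiv 𝕜 (chartMul A) (chartOne A, p) (AdE ((chart A).symm p) w, 0))
    =ᶠ[𝓝 (chartOne A)] fun p => fderiv 𝕜 (chartMul A) (p, chartOne A) (0, w) from
    (fderiv_chartMul_AdE A).mono fun p hp => hp w).fderiv_eq (𝕜 := 𝕜)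
  rw [e1.fderiv, e2.fderiv] at h
  have h' := congrArg (fun T => T v) h
  have hsymm : fderiv 𝕜 (fderiv 𝕜 (chartMul A)) (chartOne A, chartOne A) (0, v) (w, 0) =
      fderiv 𝕜 (fderiv 𝕜 (chartMul A)) (chartOne A, chartOne A) (w, 0) (0, v) :=
    ((contDiffAt_chartMul A).isSymmSndFDerivAt (by
      rw [minSmoothness_of_isRCLikeNormedField]; exact ENat.LEInfty.out)) _ _
  simp only [chart_symm_chartOne, AdE_one] at h'
  simp [fderiv_chartMul_inl, hsymm] at h'
  rw [lieE_eq, ← h']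
  simp [S]

variable {A B C : FDLieGroup 𝕜} {F : Type*} [NormedAddCommGroup F] [NormedSpace 𝕜 F]

/-! ### Calculus on Lie groups -/

lemma vder_add {f g : A → F} {a : A} (hf : MDifferentiableAt 𝓘(𝕜, A.E) 𝓘(𝕜, F) f a)
    (hg : MDifferentiableAt 𝓘(𝕜, A.E) 𝓘(𝕜, F) g a) :
    vder (fun x => f x + g x) a = vder f a + vder g a :=
  (hf.hasMFDerivAt.add hg.hasMFDerivAt).mfderiv

lemma vder_mul {f g : A → 𝕜} {a : A} (hf : MDifferentiableAt 𝓘(𝕜, A.E) 𝓘(𝕜, 𝕜) f a)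
    (hg : MDifferentiableAt 𝓘(𝕜, A.E) 𝓘(𝕜, 𝕜) g a) :
    vder (fun x => f x * g x) a = f a • vder g a + g a • vder f a :=
  (hf.hasMFDerivAt.mul hg.hasMFDerivAt).mfderiv

lemma vder_const (c : F) (a : A) : vder (fun _ => c) a = 0 := mfderiv_const

lemma vder_clm_comp {F' : Type*} [NormedAddCommGroup F'] [NormedSpace 𝕜 F'] (T : F →L[𝕜] F')
    {f : A → F} {a : A} (hf : MDifferentiableAt 𝓘(𝕜, A.E) 𝓘(𝕜, F) f a) :
    vder (fun x => T (f x)) a = T.comp (vder f a) :=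
  (T.hasMFDerivAt.comp a hf.hasMFDerivAt).mfderiv

lemma vder_congr {f g : A → F} {a : A} (h : f =ᶠ[𝓝 a] g) : vder f a = vder g a :=
  h.mfderiv_eq

/-- The differential at `1` of the right translation by `a`. -/
def rtrans (a : A) : A.E →L[𝕜] A.E := gder (fun x : A => x * a) 1

lemma vder_comp_mul_right {f : A → F} {a : A} (hf : MDifferentiableAt 𝓘(𝕜, A.E) 𝓘(𝕜, F) f a) :
    vder (fun x => f (x * a)) 1 = (vder f a).comp (rtrans a) := by
  have hf' : MDifferentiableAt 𝓘(𝕜, A.E) 𝓘(𝕜, F) f (1 * a) := by rwa [one_mul]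
  have := vder_comp (g := fun x : A => x * a) (a := 1) hf' (mdifferentiableAt_mul_right a 1)
  rw [one_mul] at this
  exact this

lemma vder_eq_zero_of_right_translate {f : A → F} {a : A}
    (hf : MDifferentiableAt 𝓘(𝕜, A.E) 𝓘(𝕜, F) f a) (h : vder (fun x => f (x * a)) 1 = 0) :
    vder f a = 0 := by
  have hf' : MDifferentiableAt 𝓘(𝕜, A.E) 𝓘(𝕜, F) (fun x => f (x * a)) (a * a⁻¹) := by
    refine MDifferentiableAt.comp (I' := 𝓘(𝕜, A.E)) (g := f) (f := fun x => x * a) (a * a⁻¹) ?_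
      (mdifferentiableAt_mul_right _ _)
    simpa using hf
  have hc := vder_comp (g := fun x : A => x * a⁻¹) (a := a) hf' (mdifferentiableAt_mul_right a⁻¹ a)
  rw [mul_inv_cancel, h] at hc
  rw [show f = (fun x => f (x * a)) ∘ (fun x => x * a⁻¹) by ext; simp, hc]
  simp

/-- A function with vanishing differential on a connected Lie group is constant. -/
lemma eq_of_vder_eq_zero [ConnectedSpace A] {f : A → F}
    (hf : MDifferentiable 𝓘(𝕜, A.E) 𝓘(𝕜, F) f) (h : ∀ a, vder f a = 0) (a b : A) : f a = f b := by
  refine IsLocallyConstant.apply_eq_of_preconnectedSpace ?_ a b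
  rw [IsLocallyConstant.iff_eventually_eq]
  intro a
  set φ := extChartAt 𝓘(𝕜, A.E) a with hφ
  let _ : NormedSpace ℝ A.E := NormedSpace.restrictScalars ℝ 𝕜 A.E
  obtain ⟨ε, hε, hball⟩ := Metric.mem_nhds_iff.1 (extChartAt_target_mem_nhds (I := 𝓘(𝕜, A.E)) a)
  have hs : ∀ p ∈ Metric.ball (φ a) ε,
      HasFDerivAt (f ∘ φ.symm) (0 : A.E →L[𝕜] F) p := by
    intro p hp
    have h1 : MDifferentiableAt 𝓘(𝕜, A.E) 𝓘(𝕜, A.E) φ.symm p :=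
      (((contMDiffOn_extChartAt_symm (n := ∞) a).contMDiffAt
        ((isOpen_extChartAt_target a).mem_nhds (hball hp)))).mdifferentiableAt (by simp)
    have h2 : HasMFDerivAt 𝓘(𝕜, A.E) 𝓘(𝕜, F) f (φ.symm p) (0 : A.E →L[𝕜] F) := by
      have := (hf (φ.symm p)).hasMFDerivAt
      rwa [show mfderiv 𝓘(𝕜, A.E) 𝓘(𝕜, F) f (φ.symm p) = (0 : A.E →L[𝕜] F) from h _] at this
    have h3 := (h2.comp p h1.hasMFDerivAt).hasFDerivAt
    exact h3.congr_fderiv (ContinuousLinearMap.zero_comp _)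
  have hconst : ∀ p ∈ Metric.ball (φ a) ε, (f ∘ φ.symm) p = (f ∘ φ.symm) (φ a) := by
    intro p hp
    refine (convex_ball (φ a) ε).is_const_of_fderivWithin_eq_zero (𝕜 := 𝕜)
      (fun q hq => (hs q hq).differentiableAt.differentiableWithinAt) (fun q hq => ?_) hp
      (Metric.mem_ball_self hε)
    rw [fderivWithin_of_isOpen Metric.isOpen_ball hq, (hs q hq).fderiv]
  have hcont : ∀ᶠ x in 𝓝 a, φ x ∈ Metric.ball (φ a) ε :=
    (continuousAt_extChartAt (I := 𝓘(𝕜, A.E)) a).eventually (Metric.ball_mem_nhds _ hε)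
  filter_upwards [hcont, extChartAt_source_mem_nhds (I := 𝓘(𝕜, A.E)) a] with x hx hxs
  have := hconst _ hx
  simp only [Function.comp] at this
  rwa [φ.left_inv hxs, φ.left_inv (mem_extChartAt_source a)] at this

/-! ### Homomorphisms of Lie groups -/

lemma mdifferentiableAt_hom {i : A →* B} (hi : ContMDiff 𝓘(𝕜, A.E) 𝓘(𝕜, B.E) ∞ i) (a : A) :
    MDifferentiableAt 𝓘(𝕜, A.E) 𝓘(𝕜, B.E) i a := hi.contMDiffAt.mdifferentiableAt (by simp)

lemma gder_hom_AdE {i : A →* B} (hi : ContMDiff 𝓘(𝕜, A.E) 𝓘(𝕜, B.E) ∞ i) (a : A) :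
    (gder i 1).comp (AdE a) = (AdE (i a)).comp (gder i 1) := by
  have h : (i : A → B) ∘ (fun x => a * x * a⁻¹) = (fun y => i a * y * (i a)⁻¹) ∘ i := by
    ext; simp
  have h1 := gder_comp (g := fun x : A => a * x * a⁻¹) (a := 1)
    (mdifferentiableAt_hom hi (a * 1 * a⁻¹)) (mdifferentiableAt_conj a 1)
  have h2 := gder_comp (mdifferentiableAt_conj (i a) (i 1)) (mdifferentiableAt_hom hi 1)
  rw [h, h2] at h1
  simp only [mul_one, mul_inv_cancel, map_one] at h1
  exact h1.symm

lemma dHom_Ad {i : A →* B} (hi : ContMDiff 𝓘(𝕜, A.E) 𝓘(𝕜, B.E) ∞ i) (a : A) (v : A.lie) :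
    dHom i (Ad a v) = Ad (i a) (dHom i v) :=
  congrArg (fun L => L v) (gder_hom_AdE hi a)

lemma mdifferentiableAt_AdE (a : A) :
    MDifferentiableAt 𝓘(𝕜, A.E) 𝓘(𝕜, A.E →L[𝕜] A.E) (AdE : A → A.E →L[𝕜] A.E) a :=
  (contMDiff_AdE A).contMDiffAt.mdifferentiableAt (by simp)

lemma vder_AdE_comp_hom {i : A →* B} (hi : ContMDiff 𝓘(𝕜, A.E) 𝓘(𝕜, B.E) ∞ i) (v : A.E)
    (w : B.E) : vder (fun x => AdE (i x)) 1 v w = lieE (gder i 1 v) w := by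
  have h := vder_comp (mdifferentiableAt_AdE (i 1)) (mdifferentiableAt_hom hi 1)
  rw [map_one] at h
  rw [← vder_AdE_one, show (fun x => AdE (i x)) = AdE ∘ i from rfl, h]
  rfl

/-- The intertwining relation of `i` with the adjoint actions, differentiated at `1`. -/
lemma gder_lieE {i : A →* B} (hi : ContMDiff 𝓘(𝕜, A.E) 𝓘(𝕜, B.E) ∞ i) (v w : A.E) :
    gder i 1 (lieE v w) = lieE (gder i 1 v) (gder i 1 w) := by
  have h1 := vder_clm_comp ((ContinuousLinearMap.compL 𝕜 A.E A.E B.E) (gder i 1))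
    (mdifferentiableAt_AdE (1 : A))
  have h2 := vder_clm_comp ((ContinuousLinearMap.compL 𝕜 A.E B.E B.E).flip (gder i 1))
    ((mdifferentiableAt_AdE (i 1)).comp 1 (mdifferentiableAt_hom hi 1))
  have h : (fun x : A => (ContinuousLinearMap.compL 𝕜 A.E A.E B.E) (gder i 1) (AdE x)) =
      fun x => (ContinuousLinearMap.compL 𝕜 A.E B.E B.E).flip (gder i 1) ((AdE ∘ i) x) := by
    ext1 x; exact gder_hom_AdE hi x
  rw [h, h2] at h1
  have h3 := congrArg (fun T => T v w) h1
  rw [← vder_AdE_one, ← vder_AdE_comp_hom hi]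
  exact h3.symm

lemma dHom_lie {i : A →* B} (hi : ContMDiff 𝓘(𝕜, A.E) 𝓘(𝕜, B.E) ∞ i) (v w : A.lie) :
    dHom i ⁅v, w⁆ = ⁅dHom i v, dHom i w⁆ := gder_lieE hi v w

lemma contMDiff_conj (a : A) :
    ContMDiff 𝓘(𝕜, A.E) 𝓘(𝕜, A.E) ∞ ((MulAut.conj a).toMonoidHom : A →* A) :=
  (contMDiff_mul_right (n := ∞) (a := a⁻¹)).comp (contMDiff_mul_left (n := ∞) (a := a))

lemma Ad_lie (a : A) (v w : A.lie) : Ad a ⁅v, w⁆ = ⁅Ad a v, Ad a w⁆ :=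
  dHom_lie (contMDiff_conj a) v w

lemma Ad_one (v : A.lie) : Ad (1 : A) v = v :=
  congrArg (fun L => L v) (AdE_one (A := A))

lemma Ad_mul (g h : A) (v : A.lie) : Ad (g * h) v = Ad g (Ad h v) :=
  congrArg (fun L => L v) (AdE_mul g h)

lemma Ad_inv_Ad (g : A) (v : A.lie) : Ad g⁻¹ (Ad g v) = v := by
  rw [← Ad_mul, inv_mul_cancel, Ad_one]

lemma Ad_Ad_inv (g : A) (v : A.lie) : Ad g (Ad g⁻¹ v) = v := by
  rw [← Ad_mul, mul_inv_cancel, Ad_one]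

lemma dHom_comp {i : A →* B} {j : B →* C} (hj : ContMDiff 𝓘(𝕜, B.E) 𝓘(𝕜, C.E) ∞ j)
    (hi : ContMDiff 𝓘(𝕜, A.E) 𝓘(𝕜, B.E) ∞ i) : dHom (j.comp i) = dHom j ∘ₗ dHom i := by
  have h := gder_comp (mdifferentiableAt_hom hj (i 1)) (mdifferentiableAt_hom hi 1)
  rw [map_one] at h
  ext v
  exact congrArg (fun L => L v) h

/-! ### Invariant derivatives -/

lemma leftDeriv_eq {f : A → 𝕜} {a : A} (hf : MDifferentiableAt 𝓘(𝕜, A.E) 𝓘(𝕜, 𝕜) f a)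
    (X : A.lie) : leftDeriv f X a = vder f a (rtrans a X) :=
  congrArg (fun L => L X) (vder_comp_mul_right hf)

lemma leftDeriv_congr {f g : A → 𝕜} {a : A} (h : f =ᶠ[𝓝 a] g) (X : A.lie) :
    leftDeriv f X a = leftDeriv g X a := by
  have h' : (fun x => f (x * a)) =ᶠ[𝓝 1] fun x => g (x * a) := by
    have := isTopologicalGroup A
    have hc : Tendsto (fun x : A => x * a) (𝓝 1) (𝓝 a) := by
      simpa using (continuous_mul_const a).tendsto (1 : A)
    exact hc.eventually h
  exact congrArg (fun L => L X) (vder_congr h')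

lemma leftDeriv_add {f g : A → 𝕜} {a : A} (hf : MDifferentiableAt 𝓘(𝕜, A.E) 𝓘(𝕜, 𝕜) f a)
    (hg : MDifferentiableAt 𝓘(𝕜, A.E) 𝓘(𝕜, 𝕜) g a) (X : A.lie) :
    leftDeriv (fun x => f x + g x) X a = leftDeriv f X a + leftDeriv g X a := by
  rw [leftDeriv_eq hf, leftDeriv_eq hg]
  refine (leftDeriv_eq (hf.add hg) X).trans ?_
  exact congrArg (fun L => L (rtrans a X)) (vder_add hf hg)

lemma leftDeriv_mul {f g : A → 𝕜} {a : A} (hf : MDifferentiableAt 𝓘(𝕜, A.E) 𝓘(𝕜, 𝕜) f a)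
    (hg : MDifferentiableAt 𝓘(𝕜, A.E) 𝓘(𝕜, 𝕜) g a) (X : A.lie) :
    leftDeriv (fun x => f x * g x) X a = f a * leftDeriv g X a + g a * leftDeriv f X a := by
  rw [leftDeriv_eq hf, leftDeriv_eq hg]
  refine (leftDeriv_eq (hf.mul hg) X).trans ?_
  exact congrArg (fun L => L (rtrans a X)) (vder_mul hf hg)

lemma leftDeriv_const (c : 𝕜) (X : A.lie) (a : A) : leftDeriv (fun _ => c) X a = 0 :=
  congrArg (fun L => L X) (vder_const (A := A) c 1)

lemma mdifferentiableAt_finset_sum {ι : Type*} (t : Finset ι) {f : ι → A → 𝕜} {a : A}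
    (hf : ∀ n ∈ t, MDifferentiableAt 𝓘(𝕜, A.E) 𝓘(𝕜, 𝕜) (f n) a) :
    MDifferentiableAt 𝓘(𝕜, A.E) 𝓘(𝕜, 𝕜) (fun x => ∑ n ∈ t, f n x) a := by
  classical
  induction t using Finset.induction_on with
  | empty => simpa using mdifferentiableAt_const
  | insert n t hn ih =>
    simp only [Finset.sum_insert hn]
    exact (hf n (by simp)).add (ih fun m hm => hf m (by simp [hm]))

lemma leftDeriv_sum {ι : Type*} (t : Finset ι) {f : ι → A → 𝕜} {a : A}
    (hf : ∀ n ∈ t, MDifferentiableAt 𝓘(𝕜, A.E) 𝓘(𝕜, 𝕜) (f n) a) (X : A.lie) :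
    leftDeriv (fun x => ∑ n ∈ t, f n x) X a = ∑ n ∈ t, leftDeriv (f n) X a := by
  classical
  induction t using Finset.induction_on with
  | empty => simpa using leftDeriv_const (A := A) 0 X a
  | insert n t hn ih =>
    simp only [Finset.sum_insert hn]
    rw [leftDeriv_add (hf n (by simp))
        (mdifferentiableAt_finset_sum t fun m hm => hf m (by simp [hm])),
      ih fun m hm => hf m (by simp [hm])]

/-- The left derivative as a linear map of the direction. -/
def leftDerivLin (f : A → 𝕜) (a : A) : A.lie →ₗ[𝕜] 𝕜 :=
  (vder (fun x => f (x * a)) 1).toLinearMap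

lemma leftDeriv_comp_hom {i : A →* B} (hi : ContMDiff 𝓘(𝕜, A.E) 𝓘(𝕜, B.E) ∞ i) {f : B → 𝕜} {a : A}
    (hf : MDifferentiableAt 𝓘(𝕜, B.E) 𝓘(𝕜, 𝕜) f (i a)) (X : A.lie) :
    leftDeriv (fun x => f (i x)) X a = leftDeriv f (dHom i X) (i a) := by
  have h1 : (fun x => f (i (x * a))) = (fun y => f (y * i a)) ∘ i := by ext; simp
  have hf' : MDifferentiableAt 𝓘(𝕜, B.E) 𝓘(𝕜, 𝕜) f (i 1 * i a) := by simpa using hf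
  have h2 := vder_comp (hf'.comp (i 1) (mdifferentiableAt_mul_right (i a) (i 1)))
    (mdifferentiableAt_hom hi 1)
  rw [map_one] at h2
  have h3 : vder (fun x => f (i (x * a))) 1 = (vder (fun y => f (y * i a)) 1).comp (gder i 1) := by
    rw [h1]; exact h2
  exact congrArg (fun L => L X) h3

lemma rightDeriv_eq_leftDeriv {f : A → 𝕜} {a : A} (hf : MDifferentiableAt 𝓘(𝕜, A.E) 𝓘(𝕜, 𝕜) f a)
    (X : A.lie) : rightDeriv f X a = leftDeriv f (Ad a X) a := by
  have h1 : (fun x => f (a * x)) = (fun y => f (y * a)) ∘ (fun x => a * x * a⁻¹) := by ext; simp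
  have hf' : MDifferentiableAt 𝓘(𝕜, A.E) 𝓘(𝕜, 𝕜) f (a * 1 * a⁻¹ * a) := by simpa using hf
  have h2 := vder_comp (g := fun x : A => a * x * a⁻¹) (a := 1)
    (hf'.comp (a * 1 * a⁻¹) (mdifferentiableAt_mul_right a (a * 1 * a⁻¹)))
    (mdifferentiableAt_conj a 1)
  simp only [mul_one, mul_inv_cancel] at h2
  have h3 : vder (fun x => f (a * x)) 1 = (vder (fun y => f (y * a)) 1).comp (AdE a) := by
    rw [h1]; exact h2
  exact congrArg (fun L => L X) h3

/-! ### Matrix coefficients of the adjoint action -/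

/-- Evaluation at a vector, as a continuous linear map on the endomorphisms of the model space. -/
def evalE (w : A.E) : (A.E →L[𝕜] A.E) →L[𝕜] A.E := ContinuousLinearMap.apply 𝕜 A.E w

/-- A linear functional on the Lie algebra, as a continuous functional on the model space. -/
def dualE (ψ : Module.Dual 𝕜 A.lie) : A.E →L[𝕜] 𝕜 :=
  LinearMap.toContinuousLinearMap (show A.E →ₗ[𝕜] 𝕜 from ψ)

lemma contMDiff_dual_Ad (ψ : Module.Dual 𝕜 B.lie) (w : B.lie) :
    ContMDiff 𝓘(𝕜, B.E) 𝓘(𝕜, 𝕜) ∞ (fun b : B => ψ (Ad b w)) :=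
  ((dualE ψ).comp (evalE w)).contMDiff.comp (contMDiff_AdE B)

lemma leftDeriv_dual_Ad (ψ : Module.Dual 𝕜 B.lie) (w X : B.lie) (b : B) :
    leftDeriv (fun b : B => ψ (Ad b w)) X b = ψ ⁅X, Ad b w⁆ := by
  have h1 : (fun x : B => ψ (Ad (x * b) w)) = fun x =>
      ((dualE ψ).comp (evalE (AdE b w))) (AdE x) := by
    ext x; rw [Ad_mul]; rfl
  have h2 : vder (fun x : B => ψ (Ad (x * b) w)) 1 =
      ((dualE ψ).comp (evalE (AdE b w))).comp (vder AdE 1) := by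
    rw [h1]; exact vder_clm_comp _ (mdifferentiableAt_AdE 1)
  have h3 := congrArg (fun L => L X) h2
  have h4 : vder (AdE : B → B.E →L[𝕜] B.E) 1 X (AdE b w) = lieE X (AdE b w) := vder_AdE_one _ _
  exact h3.trans (congrArg (dualE ψ) h4)

/-! ### Tensors and their contractions -/

section Contraction

variable {V W : Type*} [AddCommGroup V] [Module 𝕜 V] [AddCommGroup W] [Module 𝕜 W]

/-- Induction principle for the functionals on a tensor product. -/
lemma dual_tensor_induction [Module.Finite 𝕜 V] [Module.Finite 𝕜 W]
    {P : Module.Dual 𝕜 (V ⊗[𝕜] W) → Prop} (h0 : P 0) (hadd : ∀ φ ψ, P φ → P ψ → P (φ + ψ))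
    (h : ∀ (α : Module.Dual 𝕜 V) (β : Module.Dual 𝕜 W),
      P (TensorProduct.dualDistrib 𝕜 V W (α ⊗ₜ[𝕜] β)))
    (ψ : Module.Dual 𝕜 (V ⊗[𝕜] W)) : P ψ := by
  obtain ⟨x, rfl⟩ := (TensorProduct.dualDistribEquiv 𝕜 V W).surjective ψ
  have : TensorProduct.dualDistribEquiv 𝕜 V W x = TensorProduct.dualDistrib 𝕜 V W x := rfl
  rw [this]
  induction x using TensorProduct.induction_on with
  | zero => simpa using h0
  | tmul α β => exact h α β
  | add x y hx hy => rw [map_add]; exact hadd _ _ (hx rfl) (hy rfl)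

lemma tensor_ext [Module.Finite 𝕜 V] [Module.Finite 𝕜 W] {S T : V ⊗[𝕜] W}
    (h : ∀ (α : Module.Dual 𝕜 V) (β : Module.Dual 𝕜 W),
      TensorProduct.dualDistrib 𝕜 V W (α ⊗ₜ[𝕜] β) S =
        TensorProduct.dualDistrib 𝕜 V W (α ⊗ₜ[𝕜] β) T) : S = T := by
  rw [← sub_eq_zero, ← Module.forall_dual_apply_eq_zero_iff 𝕜]
  intro ψ
  rw [map_sub, sub_eq_zero]
  exact dual_tensor_induction (P := fun ψ => ψ S = ψ T) rfl
    (fun φ ψ h1 h2 => by simp [h1, h2]) h ψ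

/-- The contraction `a ⊗ b ↦ γ(b) a`. -/
def contr (γ : Module.Dual 𝕜 W) : V ⊗[𝕜] W →ₗ[𝕜] V :=
  (TensorProduct.rid 𝕜 V).toLinearMap ∘ₗ TensorProduct.map LinearMap.id γ

@[simp]
lemma contr_tmul (γ : Module.Dual 𝕜 W) (a : V) (b : W) : contr γ (a ⊗ₜ[𝕜] b) = γ b • a := by
  simp [contr]

lemma dualDistrib_eq_contr (α : Module.Dual 𝕜 V) (β : Module.Dual 𝕜 W) (T : V ⊗[𝕜] W) :
    TensorProduct.dualDistrib 𝕜 V W (α ⊗ₜ[𝕜] β) T = α (contr β T) := by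
  induction T using TensorProduct.induction_on with
  | zero => simp
  | tmul a b => simp [mul_comm]
  | add x y hx hy => simp [hx, hy]

lemma contr_comm_of_isAntisymm {T : V ⊗[𝕜] V} (hT : IsAntisymm T) (γ : Module.Dual 𝕜 V) :
    contr γ (TensorProduct.comm 𝕜 V V T) = -contr γ T := by
  rw [hT, map_neg]

lemma dualDistrib_comm (α β : Module.Dual 𝕜 V) (T : V ⊗[𝕜] V) :
    TensorProduct.dualDistrib 𝕜 V V (α ⊗ₜ[𝕜] β) (TensorProduct.comm 𝕜 V V T) =
      TensorProduct.dualDistrib 𝕜 V V (β ⊗ₜ[𝕜] α) T := by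
  induction T using TensorProduct.induction_on with
  | zero => simp
  | tmul a b => simp [mul_comm]
  | add x y hx hy => simp only [map_add, hx, hy]

lemma contr_map {V' W' : Type*} [AddCommGroup V'] [Module 𝕜 V'] [AddCommGroup W']
    [Module 𝕜 W'] (β : Module.Dual 𝕜 W') (f : V →ₗ[𝕜] V') (g : W →ₗ[𝕜] W') (T : V ⊗[𝕜] W) :
    contr β (TensorProduct.map f g T) = f (contr (β ∘ₗ g) T) := by
  induction T using TensorProduct.induction_on with
  | zero => simp
  | tmul a b => simp
  | add x y hx hy => simp only [map_add, hx, hy]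

end Contraction

section LieTensor

variable {L : Type*} [LieRing L] [LieAlgebra 𝕜 L]

/-- The functional `a ⊗ b ⊗ c ↦ α(a) β(b) γ(c)`. -/
def pair3 (α β γ : Module.Dual 𝕜 L) : Module.Dual 𝕜 (L ⊗[𝕜] (L ⊗[𝕜] L)) :=
  TensorProduct.dualDistrib 𝕜 L (L ⊗[𝕜] L)
    (α ⊗ₜ[𝕜] TensorProduct.dualDistrib 𝕜 L L (β ⊗ₜ[𝕜] γ))

lemma pair3_tmul (α β γ : Module.Dual 𝕜 L) (a : L) (T : L ⊗[𝕜] L) :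
    pair3 α β γ (a ⊗ₜ[𝕜] T) = α a * TensorProduct.dualDistrib 𝕜 L L (β ⊗ₜ[𝕜] γ) T := by
  simp [pair3]

lemma tensor3_ext [Module.Finite 𝕜 L] {S T : L ⊗[𝕜] (L ⊗[𝕜] L)}
    (h : ∀ α β γ : Module.Dual 𝕜 L, pair3 α β γ S = pair3 α β γ T) : S = T := by
  refine tensor_ext fun α ψ => ?_
  refine dual_tensor_induction (P := fun ψ =>
    TensorProduct.dualDistrib 𝕜 L (L ⊗[𝕜] L) (α ⊗ₜ[𝕜] ψ) S =
      TensorProduct.dualDistrib 𝕜 L (L ⊗[𝕜] L) (α ⊗ₜ[𝕜] ψ) T) (by simp) ?_ (h α) ψ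
  intro φ ψ h1 h2
  simp only [TensorProduct.tmul_add, map_add, LinearMap.add_apply, h1, h2]

lemma pair3_rot (α β γ : Module.Dual 𝕜 L) (T : L ⊗[𝕜] (L ⊗[𝕜] L)) :
    pair3 α β γ (rot T) = pair3 γ α β T := by
  induction T using TensorProduct.induction_on with
  | zero => simp
  | add x y hx hy => simp only [map_add, hx, hy]
  | tmul a b =>
    induction b using TensorProduct.induction_on with
    | zero => simp
    | add x y hx hy => simp only [map_add, hx, hy, TensorProduct.tmul_add]
    | tmul b c =>
      simp [pair3, rot]
      ring

lemma pair3_cycl (α β γ : Module.Dual 𝕜 L) (T : L ⊗[𝕜] (L ⊗[𝕜] L)) :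
    pair3 α β γ (cycl T) = pair3 α β γ T + pair3 γ α β T + pair3 β γ α T := by
  simp only [cycl, map_add, pair3_rot]

lemma pair3_br12_13 (α β γ : Module.Dual 𝕜 L) (S T : L ⊗[𝕜] L) :
    pair3 α β γ (br12_13 S T) = α ⁅contr β S, contr γ T⁆ := by
  induction S using TensorProduct.induction_on with
  | zero => simp [br12_13]
  | add x y hx hy =>
    simp only [br12_13, TensorProduct.add_tmul, map_add, add_lie] at hx hy ⊢
    rw [hx, hy]
  | tmul a b =>
    induction T using TensorProduct.induction_on with
    | zero => simp [br12_13]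
    | add x y hx hy =>
      simp only [br12_13, TensorProduct.tmul_add, map_add, lie_add] at hx hy ⊢
      rw [hx, hy]
    | tmul c d =>
      simp [br12_13, pair3, lieMul]
      ring

lemma pair3_br12_23 (α β γ : Module.Dual 𝕜 L) (S T : L ⊗[𝕜] L) :
    pair3 α β γ (br12_23 S T) = β ⁅contr α (TensorProduct.comm 𝕜 L L S), contr γ T⁆ := by
  induction S using TensorProduct.induction_on with
  | zero => simp [br12_23]
  | add x y hx hy =>
    simp only [br12_23, TensorProduct.add_tmul, map_add, add_lie] at hx hy ⊢
    rw [hx, hy]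
  | tmul a b =>
    induction T using TensorProduct.induction_on with
    | zero => simp [br12_23]
    | add x y hx hy =>
      simp only [br12_23, TensorProduct.tmul_add, map_add, lie_add] at hx hy ⊢
      rw [hx, hy]
    | tmul c d =>
      simp [br12_23, pair3, lieMul]
      ring

lemma pair3_br13_23 (α β γ : Module.Dual 𝕜 L) (S T : L ⊗[𝕜] L) :
    pair3 α β γ (br13_23 S T) =
      γ ⁅contr α (TensorProduct.comm 𝕜 L L S), contr β (TensorProduct.comm 𝕜 L L T)⁆ := by
  induction S using TensorProduct.induction_on with
  | zero => simp [br13_23]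
  | add x y hx hy =>
    simp only [br13_23, TensorProduct.add_tmul, map_add, add_lie] at hx hy ⊢
    rw [hx, hy]
  | tmul a b =>
    induction T using TensorProduct.induction_on with
    | zero => simp [br13_23]
    | add x y hx hy =>
      simp only [br13_23, TensorProduct.tmul_add, map_add, lie_add] at hx hy ⊢
      rw [hx, hy]
    | tmul c d =>
      simp [br13_23, pair3, lieMul]
      ring

lemma pair3_br12_23_of_isAntisymm (α β γ : Module.Dual 𝕜 L) {S : L ⊗[𝕜] L} (hS : IsAntisymm S)
    (T : L ⊗[𝕜] L) : pair3 α β γ (br12_23 S T) = -β ⁅contr α S, contr γ T⁆ := by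
  rw [pair3_br12_23, contr_comm_of_isAntisymm hS, neg_lie, map_neg]

lemma dualDistrib_adTensor (α β : Module.Dual 𝕜 L) (Z : L) {T : L ⊗[𝕜] L} (hT : IsAntisymm T) :
    TensorProduct.dualDistrib 𝕜 L L (α ⊗ₜ[𝕜] β) (adTensor Z T) =
      α ⁅Z, contr β T⁆ - β ⁅Z, contr α T⁆ := by
  have h : ∀ T : L ⊗[𝕜] L, TensorProduct.dualDistrib 𝕜 L L (α ⊗ₜ[𝕜] β) (adTensor Z T) =
      α ⁅Z, contr β T⁆ + β ⁅Z, contr α (TensorProduct.comm 𝕜 L L T)⁆ := by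
    intro T
    induction T using TensorProduct.induction_on with
    | zero => simp [adTensor]
    | tmul a b =>
      simp [adTensor]
      ring
    | add x y hx hy =>
      simp only [adTensor, map_add, lie_add] at hx hy ⊢
      linear_combination hx + hy
  rw [h, contr_comm_of_isAntisymm hT, lie_neg, map_neg, sub_eq_add_neg]

lemma adTensor_zero (Z : L) : adTensor Z (0 : L ⊗[𝕜] L) = 0 := by simp [adTensor]

lemma adTensor_add (Z : L) (S T : L ⊗[𝕜] L) : adTensor Z (S + T) = adTensor Z S + adTensor Z T := by
  simp only [adTensor, map_add]; abel

lemma isAntisymm_add {V : Type*} [AddCommGroup V] [Module 𝕜 V] {S T : V ⊗[𝕜] V}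
    (hS : IsAntisymm S) (hT : IsAntisymm T) : IsAntisymm (S + T) := by
  unfold IsAntisymm at *
  rw [map_add, hS, hT, neg_add]

/-- For antisymmetric `R`, the left-hand side of the classical Yang-Baxter equation is the cyclic
sum of `[R₁₂, R₂₃]`. -/
lemma cycl_br12_23_self [Module.Finite 𝕜 L] {R : L ⊗[𝕜] L} (hR : IsAntisymm R) :
    cycl (br12_23 R R) = yangBaxter R := by
  refine tensor3_ext fun α β γ => ?_
  rw [pair3_cycl, yangBaxter, map_add, map_add, pair3_br12_13, pair3_br13_23,
    contr_comm_of_isAntisymm hR, contr_comm_of_isAntisymm hR,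
    pair3_br12_23_of_isAntisymm _ _ _ hR, pair3_br12_23_of_isAntisymm _ _ _ hR,
    pair3_br12_23_of_isAntisymm _ _ _ hR, neg_lie, lie_neg, neg_neg,
    ← lie_skew (contr γ R) (contr β R), ← lie_skew (contr β R) (contr α R), map_neg, map_neg]
  ring

end LieTensor

/-! ### Derivatives of vector-valued functions -/

section VectorValued

variable {V : Type*} [AddCommGroup V] [Module 𝕜 V] {A B : FDLieGroup 𝕜}

/-- Differentiability at a point of a function with values in a finite-dimensional space. -/
def VDiffAt (f : A → V) (a : A) : Prop :=
  ∀ ψ : Module.Dual 𝕜 V, MDifferentiableAt 𝓘(𝕜, A.E) 𝓘(𝕜, 𝕜) (fun x => ψ (f x)) a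

lemma SmoothOn.vdiffAt {f : A → V} {U : Set A} (hf : SmoothOn f U) (hU : IsOpen U) {a : A}
    (ha : a ∈ U) : VDiffAt f a := fun ψ =>
  ((hf ψ).contMDiffAt (hU.mem_nhds ha)).mdifferentiableAt (by simp)

lemma VDiffAt.add {f g : A → V} {a : A} (hf : VDiffAt f a) (hg : VDiffAt g a) :
    VDiffAt (fun x => f x + g x) a := fun ψ => by
  simpa only [map_add] using! (hf ψ).add (hg ψ)

lemma dual_leftDerivVec [Module.Finite 𝕜 V] {f : A → V} {a : A} (hf : VDiffAt f a) (X : A.lie)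
    (ψ : Module.Dual 𝕜 V) : ψ (leftDerivVec f X a) = leftDeriv (fun x => ψ (f x)) X a := by
  have h : (fun x => ψ (f x)) = fun x => ∑ n, (Module.finBasis 𝕜 V).repr (f x) n *
      ψ (Module.finBasis 𝕜 V n) := by
    ext x
    conv_lhs => rw [← (Module.finBasis 𝕜 V).sum_repr (f x), map_sum]
    simp only [map_smul, smul_eq_mul]
  have hn : ∀ n, MDifferentiableAt 𝓘(𝕜, A.E) 𝓘(𝕜, 𝕜)
      (fun x => (Module.finBasis 𝕜 V).repr (f x) n) a := fun n =>
    hf ((Module.finBasis 𝕜 V).coord n)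
  have hm : ∀ n, MDifferentiableAt 𝓘(𝕜, A.E) 𝓘(𝕜, 𝕜) (fun x =>
      (Module.finBasis 𝕜 V).repr (f x) n * ψ (Module.finBasis 𝕜 V n)) a := fun n =>
    (hn n).mul mdifferentiableAt_const
  rw [h, leftDeriv_sum _ fun n _ => hm n, leftDerivVec, map_sum]
  refine Finset.sum_congr rfl fun n _ => ?_
  rw [leftDeriv_mul (hn n) mdifferentiableAt_const, leftDeriv_const, map_smul, smul_eq_mul]
  ring

lemma rightDerivVec_eq_leftDerivVec [Module.Finite 𝕜 V] {f : A → V} {a : A} (hf : VDiffAt f a)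
    (X : A.lie) : rightDerivVec f X a = leftDerivVec f (Ad a X) a := by
  unfold rightDerivVec leftDerivVec
  refine Finset.sum_congr rfl fun n _ => ?_
  have hn : MDifferentiableAt 𝓘(𝕜, A.E) 𝓘(𝕜, 𝕜) (fun x => (Module.finBasis 𝕜 V).repr (f x) n) a :=
    hf ((Module.finBasis 𝕜 V).coord n)
  rw [rightDeriv_eq_leftDeriv hn]

lemma eq_of_forall_dual [Module.Finite 𝕜 V] {v w : V} (h : ∀ ψ : Module.Dual 𝕜 V, ψ v = ψ w) :
    v = w := by
  rw [← sub_eq_zero, ← Module.forall_dual_apply_eq_zero_iff 𝕜]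
  intro ψ
  rw [map_sub, h, sub_self]

lemma leftDerivVec_add [Module.Finite 𝕜 V] {f g : A → V} {a : A} (hf : VDiffAt f a)
    (hg : VDiffAt g a) (X : A.lie) :
    leftDerivVec (fun x => f x + g x) X a = leftDerivVec f X a + leftDerivVec g X a := by
  refine eq_of_forall_dual (𝕜 := 𝕜) fun ψ => ?_
  rw [dual_leftDerivVec (hf.add hg), map_add, dual_leftDerivVec hf, dual_leftDerivVec hg,
    ← leftDeriv_add (hf ψ) (hg ψ)]
  simp only [map_add]

lemma VDiffAt.comp_hom {i : A →* B} (hi : ContMDiff 𝓘(𝕜, A.E) 𝓘(𝕜, B.E) ∞ i) {f : B → V} {a : A}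
    (hf : VDiffAt f (i a)) : VDiffAt (fun x => f (i x)) a := fun ψ =>
  (hf ψ).comp a (mdifferentiableAt_hom hi a)

lemma leftDerivVec_comp_hom [Module.Finite 𝕜 V] {i : A →* B}
    (hi : ContMDiff 𝓘(𝕜, A.E) 𝓘(𝕜, B.E) ∞ i) {f : B → V} {a : A} (hf : VDiffAt f (i a))
    (X : A.lie) :
    leftDerivVec (fun x => f (i x)) X a = leftDerivVec f (dHom i X) (i a) := by
  refine eq_of_forall_dual (𝕜 := 𝕜) fun ψ => ?_
  rw [dual_leftDerivVec (hf.comp_hom hi), dual_leftDerivVec hf, ← leftDeriv_comp_hom hi (hf ψ)]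

/-- The left derivative as a linear map of the direction. -/
def leftDerivVecLin [Module.Finite 𝕜 V] (f : A → V) (a : A) : A.lie →ₗ[𝕜] V :=
  ∑ n, (leftDerivLin (fun x => (Module.finBasis 𝕜 V).repr (f x) n) a).smulRight
    (Module.finBasis 𝕜 V n)

lemma leftDerivVecLin_apply [Module.Finite 𝕜 V] (f : A → V) (a : A) (X : A.lie) :
    leftDerivVecLin f a X = leftDerivVec f X a := by
  simp only [leftDerivVecLin, LinearMap.sum_apply, LinearMap.smulRight_apply]
  rfl

end VectorValued

/-! ### Bilinear expressions in the adjoint actions -/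

section BilinearAd

variable {A B C : FDLieGroup 𝕜} {i : A →* B} {j : A →* C}

lemma contMDiff_dual_Ad_comp (hi : ContMDiff 𝓘(𝕜, A.E) 𝓘(𝕜, B.E) ∞ i) (ψ : Module.Dual 𝕜 B.lie)
    (w : B.lie) : ContMDiff 𝓘(𝕜, A.E) 𝓘(𝕜, 𝕜) ∞ (fun a : A => ψ (Ad (i a) w)) :=
  (contMDiff_dual_Ad ψ w).comp hi

lemma leftDeriv_dual_Ad_comp (hi : ContMDiff 𝓘(𝕜, A.E) 𝓘(𝕜, B.E) ∞ i) (ψ : Module.Dual 𝕜 B.lie)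
    (w : B.lie) (X : A.lie) (a : A) :
    leftDeriv (fun a : A => ψ (Ad (i a) w)) X a = ψ ⁅dHom i X, Ad (i a) w⁆ := by
  rw [leftDeriv_comp_hom hi (f := fun b => ψ (Ad b w))
    ((contMDiff_dual_Ad ψ w).contMDiffAt.mdifferentiableAt (by simp)), leftDeriv_dual_Ad]

lemma bilin_eq_sum (β : B.lie →ₗ[𝕜] C.lie →ₗ[𝕜] 𝕜) (u : B.lie) (v : C.lie) :
    β u v = ∑ n, (Module.finBasis 𝕜 B.lie).coord n u * β (Module.finBasis 𝕜 B.lie n) v := by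
  conv_lhs => rw [← (Module.finBasis 𝕜 B.lie).sum_repr u, map_sum, LinearMap.sum_apply]
  simp

lemma contMDiff_bilin_Ad (hi : ContMDiff 𝓘(𝕜, A.E) 𝓘(𝕜, B.E) ∞ i)
    (hj : ContMDiff 𝓘(𝕜, A.E) 𝓘(𝕜, C.E) ∞ j) (β : B.lie →ₗ[𝕜] C.lie →ₗ[𝕜] 𝕜) (u : B.lie)
    (v : C.lie) :
    ContMDiff 𝓘(𝕜, A.E) 𝓘(𝕜, 𝕜) ∞ (fun a : A => β (Ad (i a) u) (Ad (j a) v)) := by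
  rw [show (fun a : A => β (Ad (i a) u) (Ad (j a) v)) = _ from funext fun a => bilin_eq_sum β _ _]
  exact contMDiff_finsetSum fun n _ => (contMDiff_dual_Ad_comp hi _ u).mul
    (contMDiff_dual_Ad_comp hj (β (Module.finBasis 𝕜 B.lie n)) v)

lemma leftDeriv_bilin_Ad (hi : ContMDiff 𝓘(𝕜, A.E) 𝓘(𝕜, B.E) ∞ i)
    (hj : ContMDiff 𝓘(𝕜, A.E) 𝓘(𝕜, C.E) ∞ j) (β : B.lie →ₗ[𝕜] C.lie →ₗ[𝕜] 𝕜) (u : B.lie)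
    (v : C.lie) (X : A.lie) (a : A) :
    leftDeriv (fun a : A => β (Ad (i a) u) (Ad (j a) v)) X a =
      β ⁅dHom i X, Ad (i a) u⁆ (Ad (j a) v) + β (Ad (i a) u) ⁅dHom j X, Ad (j a) v⁆ := by
  have h1 : ∀ n, MDifferentiableAt 𝓘(𝕜, A.E) 𝓘(𝕜, 𝕜)
      (fun a => (Module.finBasis 𝕜 B.lie).coord n (Ad (i a) u)) a := fun n =>
    (contMDiff_dual_Ad_comp hi _ u).contMDiffAt.mdifferentiableAt (by simp)
  have h2 : ∀ n, MDifferentiableAt 𝓘(𝕜, A.E) 𝓘(𝕜, 𝕜)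
      (fun a => β (Module.finBasis 𝕜 B.lie n) (Ad (j a) v)) a := fun n =>
    (contMDiff_dual_Ad_comp hj _ v).contMDiffAt.mdifferentiableAt (by simp)
  have h3 : ∀ n, MDifferentiableAt 𝓘(𝕜, A.E) 𝓘(𝕜, 𝕜)
      (fun a => (Module.finBasis 𝕜 B.lie).coord n (Ad (i a) u) *
        β (Module.finBasis 𝕜 B.lie n) (Ad (j a) v)) a := fun n => (h1 n).mul (h2 n)
  rw [show (fun a : A => β (Ad (i a) u) (Ad (j a) v)) = _ from funext fun a => bilin_eq_sum β _ _,
    bilin_eq_sum β ⁅dHom i X, Ad (i a) u⁆, bilin_eq_sum β (Ad (i a) u),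
    leftDeriv_sum _ fun n _ => h3 n, ← Finset.sum_add_distrib]
  refine Finset.sum_congr rfl fun n _ => ?_
  rw [leftDeriv_mul (h1 n) (h2 n), leftDeriv_dual_Ad_comp hi, leftDeriv_dual_Ad_comp hj]
  ring

/-- An infinitesimally invariant bilinear form is invariant under a connected group. -/
lemma bilin_Ad_Ad [ConnectedSpace A] (hi : ContMDiff 𝓘(𝕜, A.E) 𝓘(𝕜, B.E) ∞ i)
    (hj : ContMDiff 𝓘(𝕜, A.E) 𝓘(𝕜, C.E) ∞ j) (β : B.lie →ₗ[𝕜] C.lie →ₗ[𝕜] 𝕜)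
    (hβ : ∀ (X : A.lie) (u : B.lie) (v : C.lie), β ⁅dHom i X, u⁆ v + β u ⁅dHom j X, v⁆ = 0)
    (a : A) (u : B.lie) (v : C.lie) : β (Ad (i a) u) (Ad (j a) v) = β u v := by
  have hf : MDifferentiable 𝓘(𝕜, A.E) 𝓘(𝕜, 𝕜) (fun a : A => β (Ad (i a) u) (Ad (j a) v)) :=
    (contMDiff_bilin_Ad hi hj β u v).mdifferentiable (by simp)
  have h0 : ∀ a : A, vder (fun a : A => β (Ad (i a) u) (Ad (j a) v)) a = 0 := by
    intro a
    refine vder_eq_zero_of_right_translate (hf a) ?_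
    have hX : ∀ X : A.lie, leftDeriv (fun a : A => β (Ad (i a) u) (Ad (j a) v)) X a = 0 :=
      fun X => (leftDeriv_bilin_Ad hi hj β u v X a).trans (hβ _ _ _)
    ext X
    exact hX X
  have := eq_of_vder_eq_zero hf h0 a 1
  simpa only [map_one, Ad_one] using this

end BilinearAd

/-! ### Drinfeld doubles -/

section Double

variable {K Ks D : FDLieGroup 𝕜} {e : Ks.lie ≃ₗ[𝕜] Module.Dual 𝕜 K.lie}
  {jK : K →* D} {jKs : Ks →* D} (hD : IsDrinfeldDouble e jK jKs)

namespace IsDrinfeldDouble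

/-- The invariant scalar product of the double. -/
def form : LinearMap.BilinForm 𝕜 D.lie := hD.scalarProduct.choose

/-- The component in `𝒦` of an element of the double. -/
def prK : D.lie →ₗ[𝕜] K.lie := LinearMap.fst 𝕜 K.lie Ks.lie ∘ₗ hD.equiv.symm.toLinearMap

/-- The component in `𝒦*` of an element of the double. -/
def prKs : D.lie →ₗ[𝕜] Ks.lie := LinearMap.snd 𝕜 K.lie Ks.lie ∘ₗ hD.equiv.symm.toLinearMap

lemma form_symm (u v : D.lie) : hD.form u v = hD.form v u := hD.scalarProduct.choose_spec.1 u v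

lemma form_lie (u v w : D.lie) : hD.form ⁅u, v⁆ w = hD.form u ⁅v, w⁆ :=
  hD.scalarProduct.choose_spec.2.1 u v w

lemma form_lie_left (u v w : D.lie) : hD.form ⁅u, v⁆ w = -hD.form v ⁅u, w⁆ := by
  rw [← lie_skew, map_neg, LinearMap.neg_apply, form_lie]

@[simp]
lemma form_K_K (X Y : K.lie) : hD.form (dHom jK X) (dHom jK Y) = 0 :=
  hD.scalarProduct.choose_spec.2.2.1 X Y

@[simp]
lemma form_Ks_Ks (x y : Ks.lie) : hD.form (dHom jKs x) (dHom jKs y) = 0 :=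
  hD.scalarProduct.choose_spec.2.2.2.1 x y

@[simp]
lemma form_Ks_K (x : Ks.lie) (X : K.lie) : hD.form (dHom jKs x) (dHom jK X) = e x X :=
  hD.scalarProduct.choose_spec.2.2.2.2 x X

@[simp]
lemma form_K_Ks (x : Ks.lie) (X : K.lie) : hD.form (dHom jK X) (dHom jKs x) = e x X := by
  rw [form_symm, form_Ks_K]

lemma dHom_prK_add (w : D.lie) : dHom jK (hD.prK w) + dHom jKs (hD.prKs w) = w :=
  hD.equiv.apply_symm_apply w

lemma equiv_symm_add (X : K.lie) (x : Ks.lie) :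
    hD.equiv.symm (dHom jK X + dHom jKs x) = (X, x) := by
  rw [LinearEquiv.symm_apply_eq]; rfl

lemma prK_add (X : K.lie) (x : Ks.lie) : hD.prK (dHom jK X + dHom jKs x) = X :=
  congrArg Prod.fst (hD.equiv_symm_add X x)

lemma prKs_add (X : K.lie) (x : Ks.lie) : hD.prKs (dHom jK X + dHom jKs x) = x :=
  congrArg Prod.snd (hD.equiv_symm_add X x)

lemma form_dHom_Ks (w : D.lie) (x : Ks.lie) : hD.form w (dHom jKs x) = e x (hD.prK w) := by
  conv_lhs => rw [← hD.dHom_prK_add w]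
  simp

lemma form_dHom_K (w : D.lie) (X : K.lie) : hD.form w (dHom jK X) = e (hD.prKs w) X := by
  conv_lhs => rw [← hD.dHom_prK_add w]
  simp

/-- The scalar product of the double is nondegenerate. -/
lemma ext_form {u v : D.lie} (h1 : ∀ X, hD.form u (dHom jK X) = hD.form v (dHom jK X))
    (h2 : ∀ x, hD.form u (dHom jKs x) = hD.form v (dHom jKs x)) : u = v := by
  rw [← hD.dHom_prK_add u, ← hD.dHom_prK_add v]
  have hS : hD.prKs u = hD.prKs v := by
    apply e.injective
    ext X
    rw [← form_dHom_K, ← form_dHom_K, h1]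
  have hK : hD.prK u = hD.prK v := by
    refine eq_of_forall_dual (𝕜 := 𝕜) fun ψ => ?_
    obtain ⟨x, rfl⟩ := e.surjective ψ
    rw [← form_dHom_Ks, ← form_dHom_Ks, h2]
  rw [hS, hK]

lemma ext_form' {u v : D.lie} (h : ∀ w, hD.form u w = hD.form v w) : u = v :=
  hD.ext_form (fun _ => h _) fun _ => h _

lemma form_Ad {A : FDLieGroup 𝕜} [ConnectedSpace A] {i : A →* D}
    (hi : ContMDiff 𝓘(𝕜, A.E) 𝓘(𝕜, D.E) ∞ i) (a : A) (u v : D.lie) :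
    hD.form (Ad (i a) u) (Ad (i a) v) = hD.form u v :=
  bilin_Ad_Ad hi hi hD.form (fun X u v => by rw [form_lie_left]; ring) a u v

end IsDrinfeldDouble

lemma conjK_apply (κ : Ks) (X : K.lie) : conjK hD κ X = hD.prK (Ad (jKs κ) (dHom jK X)) := rfl

lemma conjKs_apply (κ : Ks) (X : K.lie) : conjKs hD κ X = hD.prKs (Ad (jKs κ) (dHom jK X)) := rfl

lemma Ad_dHom_K (κ : Ks) (X : K.lie) :
    Ad (jKs κ) (dHom jK X) = dHom jK (conjK hD κ X) + dHom jKs (conjKs hD κ X) :=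
  (hD.dHom_prK_add _).symm

/-- The dressing vector field, right-translated to the identity. -/
lemma dHom_Ad_conjKs_inv (κ : Ks) (X : K.lie) :
    dHom jKs (Ad κ (conjKs hD κ⁻¹ X)) = dHom jK X - Ad (jKs κ) (dHom jK (conjK hD κ⁻¹ X)) := by
  have h := congrArg (Ad (jKs κ)) (Ad_dHom_K hD κ⁻¹ X)
  rw [map_inv, Ad_Ad_inv, map_add] at h
  rw [dHom_Ad hD.dual_subgroup.smooth, h]
  abel

end Double

/-! ### The double of the subgroup inside the double of the group -/

section Reduction

variable {K Ks D H Hs DH : FDLieGroup 𝕜} {e : Ks.lie ≃ₗ[𝕜] Module.Dual 𝕜 K.lie}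
  {jK : K →* D} {jKs : Ks →* D}
  {eH : Hs.lie ≃ₗ[𝕜] Module.Dual 𝕜 H.lie} {jH : H →* DH} {jHs : Hs →* DH}
  {iH : H →* K} {iHs : Hs →* Ks} {M : Submodule 𝕜 K.lie}

namespace IsReductiveDecomposition

variable {h : Submodule 𝕜 K.lie} (hM : IsReductiveDecomposition e h M)

/-- The component in `ℳ* = ℋ^⊥` of an element of `𝒦* = ℋ* ⊕ ℳ*`. -/
def dualProj : Ks.lie →ₗ[𝕜] Ks.lie :=
  e.symm.toLinearMap ∘ₗ (M.subtype ∘ₗ M.projectionOnto h hM.isCompl).dualMap ∘ₗ e.toLinearMap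

lemma dualProj_apply (y : Ks.lie) (X : K.lie) :
    e (hM.dualProj y) X = e y (M.projectionOnto h hM.isCompl X) := by
  simp [dualProj]

lemma dualProj_of_mem_left (y : Ks.lie) {X : K.lie} (hX : X ∈ M) : e (hM.dualProj y) X = e y X := by
  rw [dualProj_apply, Submodule.projectionOnto_apply_of_mem_left _ hX]

lemma dualProj_of_mem_right (y : Ks.lie) {X : K.lie} (hX : X ∈ h) : e (hM.dualProj y) X = 0 := by
  rw [dualProj_apply, (Submodule.projectionOnto_apply_eq_zero_iff hM.isCompl).2 hX]
  simp

lemma dualProj_mem (y : Ks.lie) : e (hM.dualProj y) ∈ h.dualAnnihilator :=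
  (Submodule.mem_dualAnnihilator _).2 fun _ hX => hM.dualProj_of_mem_right y hX

lemma sub_dualProj_mem (y : Ks.lie) : e (y - hM.dualProj y) ∈ M.dualAnnihilator :=
  (Submodule.mem_dualAnnihilator _).2 fun X hX => by
    rw [map_sub, LinearMap.sub_apply, hM.dualProj_of_mem_left y hX, sub_self]

lemma exists_add (hM : IsReductiveDecomposition e h M) (X : K.lie) :
    ∃ m ∈ M, ∃ Y ∈ h, m + Y = X :=
  Submodule.mem_sup.1 (hM.isCompl.sup_eq_top ▸ Submodule.mem_top : X ∈ M ⊔ h)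

/-- `ℋ^⊥ ∩ ℳ^⊥ = 0`, in the form of an extensionality principle. -/
lemma dual_ext (hM : IsReductiveDecomposition e h M) {x y : Ks.lie}
    (h1 : ∀ X ∈ M, e x X = e y X) (h2 : ∀ X ∈ h, e x X = e y X) : x = y := by
  apply e.injective
  ext X
  obtain ⟨m, hm, Y, hY, rfl⟩ := hM.exists_add X
  rw [map_add, map_add, h1 m hm, h2 Y hY]

end IsReductiveDecomposition

/-- `iH` and `iHs` exhibit `H` and `Hs` as subgroups of `K` and `Ks` such that `Lie(Hs)` is
the annihilator of `M`, paired with `Lie(H)` by the restriction of the pairing of `𝒦*` and `𝒦`. -/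
structure IsDualSubgroup (e : Ks.lie ≃ₗ[𝕜] Module.Dual 𝕜 K.lie)
    (eH : Hs.lie ≃ₗ[𝕜] Module.Dual 𝕜 H.lie) (iH : H →* K) (iHs : Hs →* Ks)
    (M : Submodule 𝕜 K.lie) : Prop where
  subgroup : IsLieSubgroup iH
  dual_subgroup : IsLieSubgroup iHs
  mem_range_iff : ∀ x : Ks.lie, x ∈ LinearMap.range (dHom iHs) ↔ e x ∈ M.dualAnnihilator
  pairing : ∀ (x : Hs.lie) (Y : H.lie), eH x Y = e (dHom iHs x) (dHom iH Y)

/-- The embedding `ℋ ⊕ ℋ* → 𝒦 ⊕ 𝒦*` of Lie algebras of doubles. -/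
def doubleEmb (hDH : IsDrinfeldDouble eH jH jHs) (iH : H →* K) (iHs : Hs →* Ks)
    (jK : K →* D) (jKs : Ks →* D) : DH.lie →ₗ[𝕜] D.lie :=
  dHom jK ∘ₗ dHom iH ∘ₗ hDH.prK + dHom jKs ∘ₗ dHom iHs ∘ₗ hDH.prKs

namespace IsDualSubgroup

variable (hM : IsReductiveDecomposition e (LinearMap.range (dHom iH)) M)
  (hD : IsDrinfeldDouble e jK jKs) (hDH : IsDrinfeldDouble eH jH jHs)

lemma apply_of_mem (hS : IsDualSubgroup e eH iH iHs M) (x : Hs.lie) {X : K.lie} (hX : X ∈ M) :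
    e (dHom iHs x) X = 0 :=
  (Submodule.mem_dualAnnihilator _).1 ((hS.mem_range_iff _).1 ⟨x, rfl⟩) X hX

lemma exists_dHom_eq_sub_dualProj (hS : IsDualSubgroup e eH iH iHs M) (y : Ks.lie) :
    ∃ x : Hs.lie, dHom iHs x = y - hM.dualProj y :=
  (hS.mem_range_iff _).2 (hM.sub_dualProj_mem y)

lemma apply_lie_dualProj (x y : Ks.lie) (Y : H.lie) : e ⁅x, hM.dualProj y⁆ (dHom iH Y) = 0 :=
  (Submodule.mem_dualAnnihilator _).1 (hM.perp_ideal x _ (hM.dualProj_mem y)) _ ⟨Y, rfl⟩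

lemma doubleEmb_apply (w : DH.lie) : doubleEmb hDH iH iHs jK jKs w =
    dHom jK (dHom iH (hDH.prK w)) + dHom jKs (dHom iHs (hDH.prKs w)) := rfl

lemma doubleEmb_K (Y : H.lie) :
    doubleEmb hDH iH iHs jK jKs (dHom jH Y) = dHom jK (dHom iH Y) := by
  have h1 := hDH.prK_add Y 0
  have h2 := hDH.prKs_add Y 0
  rw [map_zero, add_zero] at h1 h2
  rw [doubleEmb_apply, h1, h2, map_zero, map_zero, add_zero]

lemma doubleEmb_Ks (x : Hs.lie) :
    doubleEmb hDH iH iHs jK jKs (dHom jHs x) = dHom jKs (dHom iHs x) := by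
  have h1 := hDH.prK_add 0 x
  have h2 := hDH.prKs_add 0 x
  rw [map_zero, zero_add] at h1 h2
  rw [doubleEmb_apply, h1, h2, map_zero, map_zero, zero_add]

/-- The invariance of the scalar products determines the mixed brackets, so that the embedding
of the doubles commutes with the action of `ℋ*`. -/
lemma doubleEmb_lie (hS : IsDualSubgroup e eH iH iHs M)
    (hM : IsReductiveDecomposition e (LinearMap.range (dHom iH)) M)
    (hD : IsDrinfeldDouble e jK jKs) (x : Hs.lie) (w : DH.lie) :
    doubleEmb hDH iH iHs jK jKs ⁅dHom jHs x, w⁆ =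
      ⁅dHom jKs (dHom iHs x), doubleEmb hDH iH iHs jK jKs w⁆ := by
  have hKs : ∀ y : Hs.lie, doubleEmb hDH iH iHs jK jKs ⁅dHom jHs x, dHom jHs y⁆ =
      ⁅dHom jKs (dHom iHs x), doubleEmb hDH iH iHs jK jKs (dHom jHs y)⁆ := by
    intro y
    rw [← dHom_lie hDH.dual_subgroup.smooth, doubleEmb_Ks, doubleEmb_Ks,
      dHom_lie hS.dual_subgroup.smooth, dHom_lie hD.dual_subgroup.smooth]
  have hK : ∀ Y : H.lie, doubleEmb hDH iH iHs jK jKs ⁅dHom jHs x, dHom jH Y⁆ =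
      ⁅dHom jKs (dHom iHs x), doubleEmb hDH iH iHs jK jKs (dHom jH Y)⁆ := by
    intro Y
    rw [doubleEmb_K]
    refine hD.ext_form (fun Z => ?_) fun z => ?_
    · obtain ⟨m, hm, _, ⟨Z', rfl⟩, rfl⟩ := hM.exists_add Z
      rw [doubleEmb_apply, hD.form_lie, ← dHom_lie hD.subgroup.smooth, hD.form_Ks_K, lie_add,
        map_add (e _), hS.apply_of_mem x (hM.reductive _ ⟨Y, rfl⟩ m hm), zero_add,
        ← dHom_lie hS.subgroup.smooth, ← hS.pairing, ← hDH.form_Ks_K,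
        dHom_lie hDH.subgroup.smooth, ← hDH.form_lie, hDH.form_dHom_K, map_add (dHom jK),
        map_add, map_add, LinearMap.add_apply, LinearMap.add_apply]
      simp only [IsDrinfeldDouble.form_K_K, IsDrinfeldDouble.form_Ks_K, zero_add]
      rw [hS.apply_of_mem _ hm, hS.pairing]
      ring
    · obtain ⟨z', hz'⟩ := hS.exists_dHom_eq_sub_dualProj hM z
      have hz : z = dHom iHs z' + hM.dualProj z := by rw [hz']; abel
      have h1 : e z (dHom iH (hDH.prK ⁅dHom jHs x, dHom jH Y⁆)) =
          eH z' (hDH.prK ⁅dHom jHs x, dHom jH Y⁆) := by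
        rw [hS.pairing, hz', map_sub, LinearMap.sub_apply, hM.dualProj_of_mem_right z ⟨_, rfl⟩,
          sub_zero]
      have h2 : e ⁅dHom iHs x, z⁆ (dHom iH Y) = eH ⁅x, z'⁆ Y := by
        rw [hz, lie_add, map_add, LinearMap.add_apply, apply_lie_dualProj hM, add_zero, hS.pairing,
          dHom_lie hS.dual_subgroup.smooth]
      rw [doubleEmb_apply, map_add, LinearMap.add_apply, hD.form_K_Ks, hD.form_Ks_Ks, add_zero, h1,
        ← hDH.form_dHom_Ks, hDH.form_lie_left, ← dHom_lie hDH.dual_subgroup.smooth, hDH.form_K_Ks,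
        hD.form_lie_left, ← dHom_lie hD.dual_subgroup.smooth, hD.form_K_Ks, h2]
  rw [← hDH.dHom_prK_add w, lie_add, map_add, map_add, lie_add, hKs, hK]

/-- Since `H*` is connected, the embedding of the doubles commutes with the action of `H*`. -/
lemma doubleEmb_Ad [ConnectedSpace Hs] (hS : IsDualSubgroup e eH iH iHs M)
    (hM : IsReductiveDecomposition e (LinearMap.range (dHom iH)) M)
    (hD : IsDrinfeldDouble e jK jKs) (l : Hs) (w : DH.lie) :
    doubleEmb hDH iH iHs jK jKs (Ad (jHs l) w) =
      Ad (jKs (iHs l)) (doubleEmb hDH iH iHs jK jKs w) := by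
  have hj : ContMDiff 𝓘(𝕜, Hs.E) 𝓘(𝕜, D.E) ∞ (jKs.comp iHs) :=
    hD.dual_subgroup.smooth.comp hS.dual_subgroup.smooth
  have hd : dHom (jKs.comp iHs) = dHom jKs ∘ₗ dHom iHs :=
    dHom_comp hD.dual_subgroup.smooth hS.dual_subgroup.smooth
  have key := bilin_Ad_Ad hDH.dual_subgroup.smooth hj
    (hD.form ∘ₗ doubleEmb hDH iH iHs jK jKs) (fun X u v => by
      simp only [hd, LinearMap.comp_apply, doubleEmb_lie hDH hS hM hD]
      rw [hD.form_lie_left]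
      ring) l
  refine hD.ext_form' fun v => ?_
  have h1 := key w (Ad (jKs (iHs l))⁻¹ v)
  have h2 := hD.form_Ad hj l (doubleEmb hDH iH iHs jK jKs w) (Ad (jKs (iHs l))⁻¹ v)
  simp only [LinearMap.comp_apply, MonoidHom.comp_apply, Ad_Ad_inv] at h1 h2
  rw [h1, h2]

lemma form_Ad (hS : IsDualSubgroup e eH iH iHs M) [ConnectedSpace Hs] (l : Hs) (u v : D.lie) :
    hD.form (Ad (jKs (iHs l)) u) (Ad (jKs (iHs l)) v) = hD.form u v :=
  hD.form_Ad (i := jKs.comp iHs) (hD.dual_subgroup.smooth.comp hS.dual_subgroup.smooth) l u v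

/-- The image of `ℳ` under `H*` is orthogonal to `ℋ ⊕ ℋ*`. -/
lemma form_Ad_doubleEmb [ConnectedSpace Hs] (hS : IsDualSubgroup e eH iH iHs M)
    (hM : IsReductiveDecomposition e (LinearMap.range (dHom iH)) M) (l : Hs) {u : K.lie}
    (hu : u ∈ M) (w : DH.lie) :
    hD.form (Ad (jKs (iHs l)) (dHom jK u)) (doubleEmb hDH iH iHs jK jKs w) = 0 := by
  have h := doubleEmb_Ad hDH hS hM hD l (Ad (jHs l)⁻¹ w)
  rw [Ad_Ad_inv] at h
  rw [h, hS.form_Ad hD, doubleEmb_apply, map_add, hD.form_K_K, hD.form_K_Ks,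
    hS.apply_of_mem _ hu, add_zero]

lemma conjK_mem [ConnectedSpace Hs] (hS : IsDualSubgroup e eH iH iHs M)
    (hM : IsReductiveDecomposition e (LinearMap.range (dHom iH)) M)
    (hDH : IsDrinfeldDouble eH jH jHs) (l : Hs) {u : K.lie}
    (hu : u ∈ M) : conjK hD (iHs l) u ∈ M := by
  rw [← Subspace.forall_mem_dualAnnihilator_apply_eq_zero_iff]
  intro φ hφ
  obtain ⟨x, hx⟩ := (hS.mem_range_iff (e.symm φ)).2 (by simpa using hφ)
  have h := hS.form_Ad_doubleEmb hD hDH hM l hu (dHom jHs x)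
  rw [doubleEmb_Ks, hD.form_dHom_Ks, hx, LinearEquiv.apply_symm_apply] at h
  exact h

lemma conjKs_apply_of_mem_range [ConnectedSpace Hs] (hS : IsDualSubgroup e eH iH iHs M)
    (hM : IsReductiveDecomposition e (LinearMap.range (dHom iH)) M)
    (hDH : IsDrinfeldDouble eH jH jHs) (l : Hs) {u : K.lie}
    (hu : u ∈ M) (Y : H.lie) : e (conjKs hD (iHs l) u) (dHom iH Y) = 0 := by
  have h := hS.form_Ad_doubleEmb hD hDH hM l hu (dHom jH Y)
  rwa [doubleEmb_K, hD.form_dHom_K] at h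

/-- The dressing action of `ℋ` on `H*` is the restriction of that of `𝒦` on `K*`. -/
lemma dHom_conjKs [ConnectedSpace Hs] (hS : IsDualSubgroup e eH iH iHs M)
    (hM : IsReductiveDecomposition e (LinearMap.range (dHom iH)) M) (l : Hs) (X : H.lie) :
    dHom iHs (conjKs hDH l X) = conjKs hD (iHs l) (dHom iH X) := by
  have h := doubleEmb_Ad hDH hS hM hD l (dHom jH X)
  rw [doubleEmb_K, doubleEmb_apply] at h
  rw [conjKs_apply hD, ← h, hD.prKs_add]
  rfl

end IsDualSubgroup

end Reduction

/-! ### The tensor `ρ` at a point -/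

section Rho

variable {K Ks D : FDLieGroup 𝕜} {e : Ks.lie ≃ₗ[𝕜] Module.Dual 𝕜 K.lie}
  {jK : K →* D} {jKs : Ks →* D} {h M : Submodule 𝕜 K.lie}
  (hD : IsDrinfeldDouble e jK jKs) (hM : IsReductiveDecomposition e h M)
  {ι : Type*} [Fintype ι] [DecidableEq ι] (b : Module.Basis ι 𝕜 M)

lemma formM_apply (κ : Ks) (u v : M) :
    formM hD hM κ u v = e (conjKs hD κ v) (conjM hD hM κ u) := rfl

/-- The coordinates of `rhoSol`. -/
def rhoCoef (κ : Ks) (y : Ks.lie) (m : ι) : 𝕜 :=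
  ∑ n, (constraintMatrix hD hM b κ)⁻¹ m n * e y (conjM hD hM κ (b n))

/-- The element `m` of `ℳ` for which the component of `κ m κ⁻¹` in `ℳ*` is that of `y`. -/
def rhoSol (κ : Ks) (y : Ks.lie) : M := ∑ m, rhoCoef hD hM b κ y m • b m

/-- The contraction of `ρ(κ)` with `y` in its second factor. -/
def rhoMap (κ : Ks) (y : Ks.lie) : M := conjM hD hM κ (rhoSol hD hM b κ y)

variable {κ : Ks}

lemma formM_rhoSol (hC : IsUnit (constraintMatrix hD hM b κ).det) (u : M) (y : Ks.lie) :
    formM hD hM κ u (rhoSol hD hM b κ y) = e y (conjM hD hM κ u) := by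
  have h : (formM hD hM κ).flip (rhoSol hD hM b κ y) = e y ∘ₗ M.subtype ∘ₗ conjM hD hM κ := by
    refine b.ext fun m => ?_
    have h1 : ∀ k, ∑ n, (constraintMatrix hD hM b κ) m n * (constraintMatrix hD hM b κ)⁻¹ n k =
        (1 : Matrix ι ι 𝕜) m k := fun k => by
      rw [← Matrix.mul_apply, Matrix.mul_nonsing_inv _ hC]
    calc (formM hD hM κ).flip (rhoSol hD hM b κ y) (b m)
        = ∑ n, rhoCoef hD hM b κ y n * constraintMatrix hD hM b κ m n := by
          simp [rhoSol, constraintMatrix]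
      _ = ∑ k, (∑ n, constraintMatrix hD hM b κ m n * (constraintMatrix hD hM b κ)⁻¹ n k) *
            e y (conjM hD hM κ (b k)) := by
          simp only [rhoCoef, Finset.sum_mul]
          rw [Finset.sum_comm]
          refine Finset.sum_congr rfl fun k _ => Finset.sum_congr rfl fun n _ => ?_
          ring
      _ = _ := by
          simp only [h1, Matrix.one_apply, ite_mul, one_mul, zero_mul]
          simp
  exact LinearMap.congr_fun h u

lemma conjM_surjective (hC : IsUnit (constraintMatrix hD hM b κ).det) :
    Function.Surjective (conjM hD hM κ) := by
  have := Module.Finite.of_basis b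
  rw [← LinearMap.injective_iff_surjective, injective_iff_map_eq_zero]
  intro u hu
  have h : Matrix.vecMul (fun m => b.repr u m) (constraintMatrix hD hM b κ) = 0 := by
    ext n
    have h1 : formM hD hM κ u (b n) = 0 := by rw [formM_apply, hu]; simp
    rw [← b.sum_repr u, map_sum, LinearMap.sum_apply] at h1
    simpa [Matrix.vecMul, dotProduct, constraintMatrix] using h1
  have h2 := Matrix.eq_zero_of_vecMul_eq_zero hC.ne_zero h
  rw [← b.sum_repr u]
  exact Finset.sum_eq_zero fun m _ => by rw [show b.repr u m = 0 from congrFun h2 m, zero_smul]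

lemma rhoMap_surjective (hC : IsUnit (constraintMatrix hD hM b κ).det) :
    Function.Surjective (rhoMap hD hM b κ) := by
  intro u
  obtain ⟨m, rfl⟩ := conjM_surjective hD hM b hC u
  refine ⟨conjKs hD κ m, ?_⟩
  rw [rhoMap]
  congr 1
  have hr : ∀ n, e (conjKs hD κ m) (conjM hD hM κ (b n)) =
      ∑ k, constraintMatrix hD hM b κ n k * b.repr m k := by
    intro n
    rw [← formM_apply]
    conv_lhs => rw [← b.sum_repr m, map_sum]
    simp [constraintMatrix, mul_comm]
  have hcoef : ∀ k, rhoCoef hD hM b κ (conjKs hD κ m) k = b.repr m k := by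
    intro k
    have h1 : Matrix.mulVec ((constraintMatrix hD hM b κ)⁻¹)
        (Matrix.mulVec (constraintMatrix hD hM b κ) (fun k => b.repr m k)) =
        fun k => b.repr m k := by
      rw [Matrix.mulVec_mulVec, Matrix.nonsing_inv_mul _ hC, Matrix.one_mulVec]
    rw [rhoCoef]
    simp only [hr]
    exact congrFun h1 k
  rw [rhoSol]
  simp only [hcoef, b.sum_repr]

lemma exists_dual_restrict (φ : Module.Dual 𝕜 M) (hM : IsReductiveDecomposition e h M) :
    ∃ y : Ks.lie, φ = e y ∘ₗ M.subtype := by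
  refine ⟨e.symm (φ ∘ₗ M.projectionOnto h hM.isCompl), ?_⟩
  ext u
  simp

lemma contr_rhoM (y : Ks.lie) :
    contr (e y ∘ₗ M.subtype) (rhoM hD hM b κ) = rhoMap hD hM b κ y := by
  simp only [rhoM, rhoMap, rhoSol, rhoCoef, map_sum, map_smul, contr_tmul, LinearMap.comp_apply,
    Submodule.subtype_apply, Finset.sum_smul, smul_smul]

lemma dualDistrib_rhoM (y z : Ks.lie) :
    TensorProduct.dualDistrib 𝕜 M M ((e y ∘ₗ M.subtype) ⊗ₜ[𝕜] (e z ∘ₗ M.subtype))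
      (rhoM hD hM b κ) = e y (rhoMap hD hM b κ z) := by
  rw [dualDistrib_eq_contr, contr_rhoM]
  rfl

lemma contr_rho {G : FDLieGroup 𝕜} (iK : K →* G) (γ : Module.Dual 𝕜 G.lie) :
    contr γ (rho iK hD hM b κ) = dHom iK (rhoMap hD hM b κ (e.symm (γ ∘ₗ dHom iK))) := by
  rw [rho, contr_map, ← LinearMap.comp_assoc, ← contr_rhoM]
  simp

lemma dualDistrib_rho {G : FDLieGroup 𝕜} (iK : K →* G) (β γ : Module.Dual 𝕜 G.lie) :
    TensorProduct.dualDistrib 𝕜 G.lie G.lie (β ⊗ₜ[𝕜] γ) (rho iK hD hM b κ) =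
      e (e.symm (β ∘ₗ dHom iK)) (rhoMap hD hM b κ (e.symm (γ ∘ₗ dHom iK))) := by
  rw [dualDistrib_eq_contr, contr_rho, LinearEquiv.apply_symm_apply]
  rfl

end Rho

section Subgroup

variable {K Ks D H Hs DH : FDLieGroup 𝕜} {e : Ks.lie ≃ₗ[𝕜] Module.Dual 𝕜 K.lie}
  {jK : K →* D} {jKs : Ks →* D}
  {eH : Hs.lie ≃ₗ[𝕜] Module.Dual 𝕜 H.lie} {jH : H →* DH} {jHs : Hs →* DH}
  {iH : H →* K} {iHs : Hs →* Ks} {M : Submodule 𝕜 K.lie}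
  {hM : IsReductiveDecomposition e (LinearMap.range (dHom iH)) M}
  {hD : IsDrinfeldDouble e jK jKs} {hDH : IsDrinfeldDouble eH jH jHs}
  {ι : Type*} [Fintype ι] [DecidableEq ι] {b : Module.Basis ι 𝕜 M}
  {l : Hs} [ConnectedSpace Hs]

namespace IsDualSubgroup

lemma coe_conjM (hS : IsDualSubgroup e eH iH iHs M) (hDH : IsDrinfeldDouble eH jH jHs) (u : M) :
    (conjM hD hM (iHs l) u : K.lie) = conjK hD (iHs l) u :=
  congrArg Subtype.val
    (Submodule.projectionOnto_apply_of_mem_left hM.isCompl (hS.conjK_mem hD hM hDH l u.2))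

/-- The elements `(ρ^♯ y) + y_ℳ*` of `ℳ ⊕ ℳ*` lie in `λ ℳ λ⁻¹`: the graph of `ρ(λ)` is the
image of `ℳ` under `λ`. -/
lemma Ad_rhoSol (hS : IsDualSubgroup e eH iH iHs M) (hDH : IsDrinfeldDouble eH jH jHs)
    (hC : IsUnit (constraintMatrix hD hM b (iHs l)).det) (y : Ks.lie) :
    Ad (jKs (iHs l)) (dHom jK (rhoSol hD hM b (iHs l) y)) =
      dHom jK (rhoMap hD hM b (iHs l) y) + dHom jKs (hM.dualProj y) := by
  rw [Ad_dHom_K hD, rhoMap, hS.coe_conjM hDH]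
  congr 2
  refine hM.dual_ext (fun X hX => ?_) fun X hX => ?_
  · obtain ⟨u, hu⟩ := conjM_surjective hD hM b hC ⟨X, hX⟩
    rw [hM.dualProj_of_mem_left y hX, show X = conjM hD hM (iHs l) u by rw [hu],
      ← formM_apply, formM_rhoSol hD hM b hC]
  · obtain ⟨Y, rfl⟩ := hX
    rw [hM.dualProj_of_mem_right y ⟨Y, rfl⟩,
      hS.conjKs_apply_of_mem_range hD hM hDH l (Subtype.mem _) Y]

/-- Antisymmetry of `ρ` expresses that `λ ℳ λ⁻¹` is isotropic. -/
lemma apply_rhoMap_comm (hS : IsDualSubgroup e eH iH iHs M) (hDH : IsDrinfeldDouble eH jH jHs)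
    (hC : IsUnit (constraintMatrix hD hM b (iHs l)).det) (y z : Ks.lie) :
    e y (rhoMap hD hM b (iHs l) z) = -e z (rhoMap hD hM b (iHs l) y) := by
  have h := hS.form_Ad hD l (dHom jK (rhoSol hD hM b (iHs l) y))
    (dHom jK (rhoSol hD hM b (iHs l) z))
  rw [hS.Ad_rhoSol hDH hC, hS.Ad_rhoSol hDH hC, hD.form_K_K] at h
  simp only [map_add, LinearMap.add_apply, hD.form_K_K, hD.form_K_Ks, hD.form_Ks_K, hD.form_Ks_Ks,
    hM.dualProj_of_mem_left _ (Subtype.mem _)] at h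
  linear_combination h

lemma isAntisymm_rhoM (hS : IsDualSubgroup e eH iH iHs M) (hDH : IsDrinfeldDouble eH jH jHs)
    (hC : IsUnit (constraintMatrix hD hM b (iHs l)).det) :
    IsAntisymm (rhoM hD hM b (iHs l)) := by
  refine tensor_ext fun φ ψ => ?_
  obtain ⟨y, rfl⟩ := exists_dual_restrict φ hM
  obtain ⟨z, rfl⟩ := exists_dual_restrict ψ hM
  rw [dualDistrib_comm, map_neg, dualDistrib_rhoM, dualDistrib_rhoM, hS.apply_rhoMap_comm hDH hC]

lemma isAntisymm_rho {G : FDLieGroup 𝕜} (iK : K →* G) (hS : IsDualSubgroup e eH iH iHs M)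
    (hDH : IsDrinfeldDouble eH jH jHs)
    (hC : IsUnit (constraintMatrix hD hM b (iHs l)).det) :
    IsAntisymm (rho iK hD hM b (iHs l)) := by
  refine tensor_ext fun φ ψ => ?_
  rw [dualDistrib_comm, map_neg, dualDistrib_rho, dualDistrib_rho, hS.apply_rhoMap_comm hDH hC]

lemma Ad_inv_rhoMap (hS : IsDualSubgroup e eH iH iHs M) (hDH : IsDrinfeldDouble eH jH jHs)
    (hC : IsUnit (constraintMatrix hD hM b (iHs l)).det) (y : Ks.lie) :
    Ad (jKs (iHs l)⁻¹) (dHom jK (rhoMap hD hM b (iHs l) y)) =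
      dHom jK (rhoSol hD hM b (iHs l) y) + dHom jKs (Ad (iHs l)⁻¹ (-hM.dualProj y)) := by
  have h := congrArg (Ad (jKs (iHs l))⁻¹) (hS.Ad_rhoSol hDH hC y)
  rw [Ad_inv_Ad] at h
  rw [h, map_add, dHom_Ad hD.dual_subgroup.smooth, map_inv, map_neg, map_neg]
  abel

lemma conjK_inv_rhoMap (hS : IsDualSubgroup e eH iH iHs M) (hDH : IsDrinfeldDouble eH jH jHs)
    (hC : IsUnit (constraintMatrix hD hM b (iHs l)).det) (y : Ks.lie) :
    conjK hD (iHs l)⁻¹ (rhoMap hD hM b (iHs l) y) = rhoSol hD hM b (iHs l) y := by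
  rw [conjK_apply, hS.Ad_inv_rhoMap hDH hC, hD.prK_add]

/-- The form of the Enriquez-Etingof-Marshall identity is the inverse of `ρ`. -/
lemma formM_inv_rhoMap (hS : IsDualSubgroup e eH iH iHs M) (hDH : IsDrinfeldDouble eH jH jHs)
    (hC : IsUnit (constraintMatrix hD hM b (iHs l)).det) (y : Ks.lie) :
    formM hD hM (iHs l)⁻¹ (rhoMap hD hM b (iHs l) y) = e y ∘ₗ M.subtype := by
  ext v
  have h2 : (conjM hD hM (iHs l)⁻¹ (rhoMap hD hM b (iHs l) y) : K.lie) =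
      rhoSol hD hM b (iHs l) y := by
    rw [← map_inv, hS.coe_conjM hDH, map_inv, hS.conjK_inv_rhoMap hDH hC]
  have h3 := hS.form_Ad hD l (dHom jK (rhoSol hD hM b (iHs l) y))
    (Ad (jKs (iHs l)⁻¹) (dHom jK v))
  rw [hS.Ad_rhoSol hDH hC, map_inv, Ad_Ad_inv, map_add, LinearMap.add_apply, hD.form_K_K,
    hD.form_Ks_K, zero_add, hM.dualProj_of_mem_left _ v.2, ← map_inv, Ad_dHom_K hD, map_add,
    hD.form_K_K, hD.form_K_Ks, zero_add] at h3
  rw [formM_apply, h2, ← h3]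
  rfl

lemma isEEMSigma_iff (hS : IsDualSubgroup e eH iH iHs M) (hDH : IsDrinfeldDouble eH jH jHs)
    (hC : IsUnit (constraintMatrix hD hM b (iHs l)).det) (s : M ⊗[𝕜] M) :
    IsEEMSigma hD hM (iHs l) s ↔ s = rhoM hD hM b (iHs l) := by
  constructor
  · intro hs
    refine tensor_ext fun φ ψ => ?_
    obtain ⟨y, rfl⟩ := exists_dual_restrict φ hM
    obtain ⟨z, rfl⟩ := exists_dual_restrict ψ hM
    rw [dualDistrib_rhoM, ← hS.formM_inv_rhoMap hDH hC, ← hS.formM_inv_rhoMap hDH hC,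
      ← hs.identity, hS.formM_inv_rhoMap hDH hC]
    rfl
  · rintro rfl
    refine ⟨hS.isAntisymm_rhoM hDH hC, fun u v => ?_⟩
    obtain ⟨y, rfl⟩ := rhoMap_surjective hD hM b hC u
    obtain ⟨z, rfl⟩ := rhoMap_surjective hD hM b hC v
    rw [hS.formM_inv_rhoMap hDH hC, hS.formM_inv_rhoMap hDH hC, dualDistrib_rhoM]
    rfl

/-- The dressing vector field of `ρ^♯ y` at `λ` is `-y_ℳ*`, right-translated to the identity. -/
lemma Ad_conjKs_rhoMap (hS : IsDualSubgroup e eH iH iHs M) (hDH : IsDrinfeldDouble eH jH jHs)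
    (hC : IsUnit (constraintMatrix hD hM b (iHs l)).det) (y : Ks.lie) :
    Ad (iHs l) (conjKs hD (iHs l)⁻¹ (rhoMap hD hM b (iHs l) y)) = -hM.dualProj y := by
  apply hD.dual_subgroup.immersion
  rw [dHom_Ad_conjKs_inv hD, hS.conjK_inv_rhoMap hDH hC, hS.Ad_rhoSol hDH hC, map_neg]
  abel

end IsDualSubgroup

end Subgroup

/-! ### Smoothness and derivative of `ρ` -/

lemma contMDiffAt_det {A : FDLieGroup 𝕜} {ι : Type*} [Fintype ι] [DecidableEq ι]
    {N : A → Matrix ι ι 𝕜} {a : A}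
    (hN : ∀ m n, ContMDiffAt 𝓘(𝕜, A.E) 𝓘(𝕜, 𝕜) ∞ (fun x => N x m n) a) :
    ContMDiffAt 𝓘(𝕜, A.E) 𝓘(𝕜, 𝕜) ∞ (fun x => (N x).det) a := by
  simp only [Matrix.det_apply']
  exact contMDiffAt_finsetSum fun σ _ =>
    contMDiffAt_const.mul (contMDiffAt_finsetProd fun m _ => hN _ _)

lemma contMDiffAt_inv_apply {A : FDLieGroup 𝕜} {ι : Type*} [Fintype ι] [DecidableEq ι]
    {N : A → Matrix ι ι 𝕜} {a : A}
    (hN : ∀ m n, ContMDiffAt 𝓘(𝕜, A.E) 𝓘(𝕜, 𝕜) ∞ (fun x => N x m n) a)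
    (hu : IsUnit (N a).det) (m n : ι) :
    ContMDiffAt 𝓘(𝕜, A.E) 𝓘(𝕜, 𝕜) ∞ (fun x => (N x)⁻¹ m n) a := by
  simp only [Matrix.inv_def, Ring.inverse_eq_inv', Matrix.smul_apply, smul_eq_mul,
    Matrix.adjugate_apply]
  refine ((contMDiffAt_det hN).inv₀ hu.ne_zero).mul (contMDiffAt_det fun p q => ?_)
  simp only [Matrix.updateRow_apply]
  split_ifs
  · exact contMDiffAt_const
  · exact hN p q

namespace IsDualSubgroup

variable {K Ks D H Hs DH : FDLieGroup 𝕜} {e : Ks.lie ≃ₗ[𝕜] Module.Dual 𝕜 K.lie}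
  {jK : K →* D} {jKs : Ks →* D}
  {eH : Hs.lie ≃ₗ[𝕜] Module.Dual 𝕜 H.lie} {jH : H →* DH} {jHs : Hs →* DH}
  {iH : H →* K} {iHs : Hs →* Ks} {M : Submodule 𝕜 K.lie}
  {hM : IsReductiveDecomposition e (LinearMap.range (dHom iH)) M}
  {hD : IsDrinfeldDouble e jK jKs} {hDH : IsDrinfeldDouble eH jH jHs}
  {ι : Type*} [Fintype ι] [DecidableEq ι] {b : Module.Basis ι 𝕜 M}
  {l : Hs}

lemma contMDiff_comp (hS : IsDualSubgroup e eH iH iHs M) (hD : IsDrinfeldDouble e jK jKs) :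
    ContMDiff 𝓘(𝕜, Hs.E) 𝓘(𝕜, D.E) ∞ (jKs.comp iHs) :=
  hD.dual_subgroup.smooth.comp hS.dual_subgroup.smooth

lemma contMDiff_conjM (hS : IsDualSubgroup e eH iH iHs M) (y : Ks.lie) (u : M) :
    ContMDiff 𝓘(𝕜, Hs.E) 𝓘(𝕜, 𝕜) ∞ (fun l => e y (conjM hD hM (iHs l) u)) :=
  contMDiff_dual_Ad_comp (hS.contMDiff_comp hD)
    (e y ∘ₗ M.subtype ∘ₗ M.projectionOnto _ hM.isCompl ∘ₗ hD.prK) (dHom jK u)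

lemma contMDiff_formM (hS : IsDualSubgroup e eH iH iHs M) (u v : M) :
    ContMDiff 𝓘(𝕜, Hs.E) 𝓘(𝕜, 𝕜) ∞ (fun l => formM hD hM (iHs l) u v) :=
  contMDiff_bilin_Ad (hS.contMDiff_comp hD) (hS.contMDiff_comp hD)
    ((Module.Dual.eval 𝕜 K.lie).compl₁₂ (M.subtype ∘ₗ M.projectionOnto _ hM.isCompl ∘ₗ hD.prK)
      (e.toLinearMap ∘ₗ hD.prKs)) (dHom jK u) (dHom jK v)

lemma contMDiffAt_rhoCoef (hS : IsDualSubgroup e eH iH iHs M)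
    (hC : IsUnit (constraintMatrix hD hM b (iHs l)).det) (y : Ks.lie) (m : ι) :
    ContMDiffAt 𝓘(𝕜, Hs.E) 𝓘(𝕜, 𝕜) ∞ (fun l => rhoCoef hD hM b (iHs l) y m) l :=
  contMDiffAt_finsetSum fun n _ =>
    (contMDiffAt_inv_apply (fun p q => (hS.contMDiff_formM (b p) (b q)).contMDiffAt) hC m n).mul
      (hS.contMDiff_conjM y (b n)).contMDiffAt

lemma apply_rhoMap_eq_sum (κ : Ks) (y z : Ks.lie) : e y (rhoMap hD hM b κ z) =
    ∑ m, rhoCoef hD hM b κ z m * e y (conjM hD hM κ (b m)) := by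
  simp [rhoMap, rhoSol]

lemma contMDiffAt_rhoMap (hS : IsDualSubgroup e eH iH iHs M)
    (hC : IsUnit (constraintMatrix hD hM b (iHs l)).det) (y z : Ks.lie) :
    ContMDiffAt 𝓘(𝕜, Hs.E) 𝓘(𝕜, 𝕜) ∞ (fun l => e y (rhoMap hD hM b (iHs l) z)) l := by
  simp only [apply_rhoMap_eq_sum]
  exact contMDiffAt_finsetSum fun m _ =>
    (hS.contMDiffAt_rhoCoef hC z m).mul (hS.contMDiff_conjM y (b m)).contMDiffAt

lemma smoothOn_rho {G : FDLieGroup 𝕜} (iK : K →* G) (hS : IsDualSubgroup e eH iH iHs M)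
    {V : Set Hs} (hC : ∀ l ∈ V, IsUnit (constraintMatrix hD hM b (iHs l)).det) :
    SmoothOn (fun l => rho iK hD hM b (iHs l)) V := by
  intro ψ l hl
  refine ContMDiffAt.contMDiffWithinAt ?_
  refine dual_tensor_induction (P := fun ψ : Module.Dual 𝕜 (G.lie ⊗[𝕜] G.lie) =>
    ContMDiffAt 𝓘(𝕜, Hs.E) 𝓘(𝕜, 𝕜) ∞ (fun l => ψ (rho iK hD hM b (iHs l))) l) ?_ ?_ ?_ ψ
  · exact contMDiffAt_const
  · exact fun φ ψ hφ hψ => hφ.add hψ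
  · intro α β
    simp only [dualDistrib_rho]
    exact hS.contMDiffAt_rhoMap (hC l hl) _ _

/-- The derivative of `ρ` along `ℋ*`. As `λ ℳ λ⁻¹` is isotropic, the variation of the element of
`ℳ` that represents `z` does not contribute. -/
lemma leftDeriv_rhoMap [ConnectedSpace Hs] (hS : IsDualSubgroup e eH iH iHs M)
    (hDH : IsDrinfeldDouble eH jH jHs) {V : Set Hs} (hV : IsOpen V)
    (hC : ∀ l ∈ V, IsUnit (constraintMatrix hD hM b (iHs l)).det) (hl : l ∈ V)
    (x : Hs.lie) (y z : Ks.lie) :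
    leftDeriv (fun l => e y (rhoMap hD hM b (iHs l) z)) x l =
      hD.form (dHom jK (rhoMap hD hM b (iHs l) y) + dHom jKs (hM.dualProj y))
        ⁅dHom jKs (dHom iHs x),
          dHom jK (rhoMap hD hM b (iHs l) z) + dHom jKs (hM.dualProj z)⁆ := by
  rw [← hS.Ad_rhoSol hDH (hC l hl), ← hS.Ad_rhoSol hDH (hC l hl)]
  -- `w` is frozen at `l`: near `l`, `ρ` is, up to the constant `c`,
  -- the pairing of `w` with the graph
  set w := Ad (jKs (iHs l)) (dHom jK (rhoSol hD hM b (iHs l) y)) with hw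
  set c : 𝕜 := e (hM.dualProj z) (rhoMap hD hM b (iHs l) y)
  have hev : (fun l' => e y (rhoMap hD hM b (iHs l') z)) =ᶠ[𝓝 l] fun l' =>
      ∑ m, rhoCoef hD hM b (iHs l') z m * hD.form w (Ad ((jKs.comp iHs) l') (dHom jK (b m)))
        + -c := by
    filter_upwards [hV.mem_nhds hl] with l' hl'
    have h1 : ∑ m, rhoCoef hD hM b (iHs l') z m *
        hD.form w (Ad ((jKs.comp iHs) l') (dHom jK (b m))) =
        hD.form w (Ad (jKs (iHs l')) (dHom jK (rhoSol hD hM b (iHs l') z))) := by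
      simp [rhoSol]
    rw [h1, hS.Ad_rhoSol hDH (hC l' hl'), hw, hS.Ad_rhoSol hDH (hC l hl)]
    simp only [map_add, LinearMap.add_apply, hD.form_K_K, hD.form_K_Ks, hD.form_Ks_K,
      hD.form_Ks_Ks, hM.dualProj_of_mem_left y (Subtype.mem _), c]
    ring
  have hs : ∀ m, MDifferentiableAt 𝓘(𝕜, Hs.E) 𝓘(𝕜, 𝕜)
      (fun l' => rhoCoef hD hM b (iHs l') z m) l := fun m =>
    (hS.contMDiffAt_rhoCoef (hC l hl) z m).mdifferentiableAt (by simp)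
  have hA : ∀ m, MDifferentiableAt 𝓘(𝕜, Hs.E) 𝓘(𝕜, 𝕜)
      (fun l' => hD.form w (Ad ((jKs.comp iHs) l') (dHom jK (b m)))) l := fun m =>
    (contMDiff_dual_Ad_comp (hS.contMDiff_comp hD) (hD.form w)
      (dHom jK (b m))).contMDiffAt.mdifferentiableAt (by simp)
  have hsA : ∀ m, MDifferentiableAt 𝓘(𝕜, Hs.E) 𝓘(𝕜, 𝕜) (fun l' => rhoCoef hD hM b (iHs l') z m *
      hD.form w (Ad ((jKs.comp iHs) l') (dHom jK (b m)))) l := fun m => (hs m).mul (hA m)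
  have hd : dHom (jKs.comp iHs) = dHom jKs ∘ₗ dHom iHs :=
    dHom_comp hD.dual_subgroup.smooth hS.dual_subgroup.smooth
  have hiso : ∀ m, hD.form w (Ad (jKs (iHs l)) (dHom jK (b m))) = 0 := fun m => by
    rw [hw, hS.form_Ad hD, hD.form_K_K]
  rw [leftDeriv_congr hev, leftDeriv_add (mdifferentiableAt_finset_sum _ fun m _ => hsA m)
    mdifferentiableAt_const, leftDeriv_const, add_zero, leftDeriv_sum _ fun m _ => hsA m]
  have hterm : ∀ m, leftDeriv (fun l' => rhoCoef hD hM b (iHs l') z m *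
      hD.form w (Ad ((jKs.comp iHs) l') (dHom jK (b m)))) x l =
      rhoCoef hD hM b (iHs l) z m * hD.form w
        ⁅dHom jKs (dHom iHs x), Ad (jKs (iHs l)) (dHom jK (b m))⁆ := by
    intro m
    rw [leftDeriv_mul (hs m) (hA m), leftDeriv_dual_Ad_comp (hS.contMDiff_comp hD) (hD.form w), hd]
    simp only [MonoidHom.comp_apply, LinearMap.comp_apply, hiso, zero_mul, add_zero]
  simp only [hterm]
  have hsum : Ad (jKs (iHs l)) (dHom jK (rhoSol hD hM b (iHs l) z)) =
      ∑ m, rhoCoef hD hM b (iHs l) z m • Ad (jKs (iHs l)) (dHom jK (b m)) := by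
    simp [rhoSol]
  rw [hsum, lie_sum, map_sum]
  refine Finset.sum_congr rfl fun m _ => ?_
  rw [lie_smul, map_smul, smul_eq_mul]

end IsDualSubgroup

/-! ### Reduction of the dynamical `r`-matrix -/

/-- Pairing the derivative term `∑ K^a ⊗ L_{K_a} F` of the dynamical Yang-Baxter equation with
`α ⊗ ψ` gives the derivative of `ψ ∘ F` along the restriction of `α` to `𝒦`. -/
lemma pair3_sum_leftDerivVec {G K Ks : FDLieGroup 𝕜} (e : Ks.lie ≃ₗ[𝕜] Module.Dual 𝕜 K.lie)
    (T : K.lie →ₗ[𝕜] G.lie) (F : Ks → G.lie ⊗[𝕜] G.lie) (κ : Ks) (α β γ : Module.Dual 𝕜 G.lie) :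
    pair3 α β γ (∑ a, T (Module.finBasis 𝕜 K.lie a) ⊗ₜ[𝕜]
        leftDerivVec F (e.symm ((Module.finBasis 𝕜 K.lie).coord a)) κ) =
      TensorProduct.dualDistrib 𝕜 G.lie G.lie (β ⊗ₜ[𝕜] γ)
        (leftDerivVec F (e.symm (α ∘ₗ T)) κ) := by
  have h : α ∘ₗ T = ∑ a, α (T (Module.finBasis 𝕜 K.lie a)) • (Module.finBasis 𝕜 K.lie).coord a := by
    refine (Module.finBasis 𝕜 K.lie).ext fun m => ?_
    simp [Finsupp.single_apply]
  rw [h, map_sum, map_sum, ← leftDerivVecLin_apply, map_sum, map_sum]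
  refine Finset.sum_congr rfl fun a _ => ?_
  rw [pair3_tmul, map_smul, map_smul, map_smul, smul_eq_mul, leftDerivVecLin_apply]

namespace IsDualSubgroup

variable {G K Ks D H Hs DH : FDLieGroup 𝕜} {e : Ks.lie ≃ₗ[𝕜] Module.Dual 𝕜 K.lie}
  {jK : K →* D} {jKs : Ks →* D}
  {eH : Hs.lie ≃ₗ[𝕜] Module.Dual 𝕜 H.lie} {jH : H →* DH} {jHs : Hs →* DH}
  {iK : K →* G} {iH : H →* K} {iHs : Hs →* Ks} {M : Submodule 𝕜 K.lie}
  {R : G.lie ⊗[𝕜] G.lie}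
  {hM : IsReductiveDecomposition e (LinearMap.range (dHom iH)) M}
  {hD : IsDrinfeldDouble e jK jKs} {hDH : IsDrinfeldDouble eH jH jHs}
  {ι : Type*} [Fintype ι] [DecidableEq ι] {b : Module.Basis ι 𝕜 M}
  {l : Hs}

/-- `H*` is a dual group of `H`: extensions to `𝒢` of elements of `ℋ*` restrict to elements of
`𝒦*` that are determined up to the ideal `ℋ^⊥`. -/
lemma isDualGroup (hS : IsDualSubgroup e eH iH iHs M)
    (hM : IsReductiveDecomposition e (LinearMap.range (dHom iH)) M)
    (hiK : IsLieSubgroup iK) (he : IsDualGroup R iK e) : IsDualGroup R (iK.comp iH) eH := by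
  intro x y α β hα hβ X
  have hcomp : dHom (iK.comp iH) = dHom iK ∘ₗ dHom iH := dHom_comp hiK.smooth hS.subgroup.smooth
  rw [hcomp] at hα hβ ⊢
  have key : ∀ (x : Hs.lie) (α : Module.Dual 𝕜 G.lie), α ∘ₗ (dHom iK ∘ₗ dHom iH) = eH x →
      ∃ ξ, e.symm (α ∘ₗ dHom iK) = dHom iHs x + hM.dualProj ξ := by
    intro x α hα
    refine ⟨e.symm (α ∘ₗ dHom iK), hM.dual_ext (fun m hm => ?_) ?_⟩
    · rw [map_add e, LinearMap.add_apply, hS.apply_of_mem x hm, zero_add,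
        hM.dualProj_of_mem_left _ hm]
    · rintro _ ⟨Y, rfl⟩
      rw [map_add e, LinearMap.add_apply, hM.dualProj_of_mem_right _ ⟨Y, rfl⟩, add_zero,
        ← hS.pairing, ← hα, LinearEquiv.apply_symm_apply]
      rfl
  -- brackets with `ℋ^⊥` vanish on `ℋ`, as `ℋ^⊥` is an ideal
  obtain ⟨ξ, hξ⟩ := key x α hα
  obtain ⟨η, hη⟩ := key y β hβ
  have h := he _ _ α β (e.apply_symm_apply _).symm (e.apply_symm_apply _).symm (dHom iH X)
  rw [LinearMap.comp_apply, ← h, hξ, hη, hS.pairing, dHom_lie hS.dual_subgroup.smooth, lie_add,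
    map_add e, LinearMap.add_apply, apply_lie_dualProj hM, add_zero, add_lie, map_add e,
    LinearMap.add_apply, ← lie_skew (hM.dualProj ξ) (dHom iHs y), map_neg, LinearMap.neg_apply,
    apply_lie_dualProj hM, neg_zero, add_zero]

lemma vdiffAt_rho (iK : K →* G) (hS : IsDualSubgroup e eH iH iHs M) {V : Set Hs} (hV : IsOpen V)
    (hC : ∀ l ∈ V, IsUnit (constraintMatrix hD hM b (iHs l)).det) (hl : l ∈ V) :
    VDiffAt (fun l => rho iK hD hM b (iHs l)) l :=
  (hS.smoothOn_rho iK hC).vdiffAt hV hl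

section Connected

variable [ConnectedSpace Hs]

/-- `⟪[u, v], w⟫ = 0` for `u, v, w` in the graph of `ρ(λ)`, since the graph is contained in the
isotropic subalgebra `λ 𝒦 λ⁻¹`. -/
lemma form_lie_graph (hS : IsDualSubgroup e eH iH iHs M) (hDH : IsDrinfeldDouble eH jH jHs)
    (hC : IsUnit (constraintMatrix hD hM b (iHs l)).det) (x y z : Ks.lie) :
    e (hM.dualProj x) ⁅(rhoMap hD hM b (iHs l) y : K.lie), (rhoMap hD hM b (iHs l) z : K.lie)⁆ +
      e (hM.dualProj y) ⁅(rhoMap hD hM b (iHs l) z : K.lie), (rhoMap hD hM b (iHs l) x : K.lie)⁆ +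
      e (hM.dualProj z) ⁅(rhoMap hD hM b (iHs l) x : K.lie), (rhoMap hD hM b (iHs l) y : K.lie)⁆ +
      e ⁅hM.dualProj x, hM.dualProj y⁆ (rhoMap hD hM b (iHs l) z) +
      e ⁅hM.dualProj y, hM.dualProj z⁆ (rhoMap hD hM b (iHs l) x) +
      e ⁅hM.dualProj z, hM.dualProj x⁆ (rhoMap hD hM b (iHs l) y) = 0 := by
  have h : hD.form ⁅Ad (jKs (iHs l)) (dHom jK (rhoSol hD hM b (iHs l) x)),
      Ad (jKs (iHs l)) (dHom jK (rhoSol hD hM b (iHs l) y))⁆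
      (Ad (jKs (iHs l)) (dHom jK (rhoSol hD hM b (iHs l) z))) = 0 := by
    rw [← Ad_lie, hS.form_Ad hD, ← dHom_lie hD.subgroup.smooth, hD.form_K_K]
  rw [hS.Ad_rhoSol hDH hC, hS.Ad_rhoSol hDH hC, hS.Ad_rhoSol hDH hC] at h
  set X := (rhoMap hD hM b (iHs l) x : K.lie)
  set Y := (rhoMap hD hM b (iHs l) y : K.lie)
  set Z := (rhoMap hD hM b (iHs l) z : K.lie)
  set ξ := hM.dualProj x
  set η := hM.dualProj y
  set ζ := hM.dualProj z
  have h1 : ∀ (X Z : K.lie) (η : Ks.lie),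
      hD.form ⁅dHom jK X, dHom jKs η⁆ (dHom jK Z) = e η ⁅Z, X⁆ := fun X Z η => by
    rw [hD.form_lie_left, ← dHom_lie hD.subgroup.smooth, hD.form_Ks_K, ← lie_skew, map_neg, neg_neg]
  have h2 : ∀ (X : K.lie) (η ζ : Ks.lie),
      hD.form ⁅dHom jK X, dHom jKs η⁆ (dHom jKs ζ) = e ⁅η, ζ⁆ X := fun X η ζ => by
    rw [hD.form_lie, ← dHom_lie hD.dual_subgroup.smooth, hD.form_K_Ks]
  have h3 : ∀ (Y Z : K.lie) (ξ : Ks.lie),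
      hD.form ⁅dHom jKs ξ, dHom jK Y⁆ (dHom jK Z) = e ξ ⁅Y, Z⁆ := fun Y Z ξ => by
    rw [hD.form_lie, ← dHom_lie hD.subgroup.smooth, hD.form_Ks_K]
  have h4 : ∀ (Y : K.lie) (ξ ζ : Ks.lie),
      hD.form ⁅dHom jKs ξ, dHom jK Y⁆ (dHom jKs ζ) = e ⁅ζ, ξ⁆ Y := fun Y ξ ζ => by
    rw [hD.form_lie_left, ← dHom_lie hD.dual_subgroup.smooth, hD.form_K_Ks, ← lie_skew, map_neg,
      LinearMap.neg_apply, neg_neg]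
  simp only [add_lie, lie_add, map_add, LinearMap.add_apply, h1, h2, h3, h4,
    ← dHom_lie hD.subgroup.smooth, ← dHom_lie hD.dual_subgroup.smooth, hD.form_K_K, hD.form_K_Ks,
    hD.form_Ks_K, hD.form_Ks_Ks] at h
  linear_combination h

/-- The part of the dynamical Yang-Baxter equation that involves only `ρ` and `R`, paired with
`x ⊗ y ⊗ z`; the bracket of `𝒦*` stands for `R`. -/
lemma cyclic_sum_rhoMap (hS : IsDualSubgroup e eH iH iHs M) (hDH : IsDrinfeldDouble eH jH jHs)
    (hC : IsUnit (constraintMatrix hD hM b (iHs l)).det)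
    {P : Ks.lie → K.lie} (hP : ∀ y, P y = rhoMap hD hM b (iHs l) y)
    {Ξ : Ks.lie → Ks.lie → Ks.lie → 𝕜} (hΞ : ∀ x y z, Ξ x y z = e ⁅y, z⁆ (P x) - e y ⁅P x, P z⁆ +
      hD.form (dHom jK (P y) + dHom jKs (hM.dualProj y))
        ⁅dHom jKs (x - hM.dualProj x), dHom jK (P z) + dHom jKs (hM.dualProj z)⁆)
    (x y z : Ks.lie) : Ξ x y z + Ξ z x y + Ξ y z x = 0 := by
  have hgraph := hS.form_lie_graph hDH hC x y z
  simp only [← hP] at hgraph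
  -- `ℳ^⊥` is a subalgebra
  have h0 : ∀ x y z, e ⁅y - hM.dualProj y, z - hM.dualProj z⁆ (P x) = 0 := fun x y z =>
    (Submodule.mem_dualAnnihilator _).1 (hM.dual_subalgebra _ _ (hM.sub_dualProj_mem y)
      (hM.sub_dualProj_mem z)) _ (by rw [hP]; exact Subtype.mem _)
  have hform : ∀ x y z, hD.form (dHom jK (P y) + dHom jKs (hM.dualProj y))
      ⁅dHom jKs (x - hM.dualProj x), dHom jK (P z) + dHom jKs (hM.dualProj z)⁆ =
      e (x - hM.dualProj x) ⁅P z, P y⁆ + e ⁅x - hM.dualProj x, hM.dualProj z⁆ (P y) +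
        e ⁅hM.dualProj y, x - hM.dualProj x⁆ (P z) := by
    intro x y z
    have h1 : hD.form (dHom jK (P y)) ⁅dHom jKs (x - hM.dualProj x), dHom jK (P z)⁆ =
        e (x - hM.dualProj x) ⁅P z, P y⁆ := by
      rw [hD.form_symm, hD.form_lie, ← dHom_lie hD.subgroup.smooth, hD.form_Ks_K]
    have h2 : hD.form (dHom jKs (hM.dualProj y)) ⁅dHom jKs (x - hM.dualProj x), dHom jK (P z)⁆ =
        e ⁅hM.dualProj y, x - hM.dualProj x⁆ (P z) := by
      rw [← hD.form_lie, ← dHom_lie hD.dual_subgroup.smooth, hD.form_Ks_K]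
    rw [lie_add, ← dHom_lie hD.dual_subgroup.smooth, map_add, map_add, LinearMap.add_apply,
      LinearMap.add_apply, h1, h2, hD.form_K_Ks, hD.form_Ks_Ks]
    ring
  simp only [hΞ, hform]
  have g1 := h0 x y z
  have g2 := h0 z x y
  have g3 := h0 y z x
  have s1 : ∀ x y z, e ⁅x, y⁆ (P z) = -e ⁅y, x⁆ (P z) := fun x y z => by
    rw [← lie_skew, map_neg, LinearMap.neg_apply]
  have s2 : ∀ x y z, e x ⁅P y, P z⁆ = -e x ⁅P z, P y⁆ := fun x y z => by
    rw [← lie_skew, map_neg]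
  simp only [sub_lie, lie_sub, map_sub, LinearMap.sub_apply] at g1 g2 g3 ⊢
  linear_combination g1 + g2 + g3 + hgraph
    - s2 (hM.dualProj x) y z - s2 (hM.dualProj y) z x - s2 (hM.dualProj z) x y
    + s1 z (hM.dualProj y) x + s1 x (hM.dualProj z) y + s1 y (hM.dualProj x) z
    + s1 (hM.dualProj z) y x + s1 (hM.dualProj x) z y + s1 (hM.dualProj y) x z
    - 2 * s1 (hM.dualProj z) (hM.dualProj y) x - 2 * s1 (hM.dualProj x) (hM.dualProj z) y
    - 2 * s1 (hM.dualProj y) (hM.dualProj x) z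

/-- For `X ∈ ℋ`, the dressing vector field, mapped to the double. -/
lemma dHom_Ad_conjKs (hS : IsDualSubgroup e eH iH iHs M) (hDH : IsDrinfeldDouble eH jH jHs)
    (hM : IsReductiveDecomposition e (LinearMap.range (dHom iH)) M)
    (hD : IsDrinfeldDouble e jK jKs) (l : Hs) (X : H.lie) :
    dHom iHs (Ad l (conjKs hDH l⁻¹ X)) = Ad (iHs l) (conjKs hD (iHs l)⁻¹ (dHom iH X)) := by
  rw [dHom_Ad hS.dual_subgroup.smooth, hS.dHom_conjKs hD hDH hM, map_inv]

/-- The derivative of `ρ` along `ℋ*`, paired with `β ⊗ γ`. -/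
lemma dualDistrib_leftDerivVec_rho (iK : K →* G) (hS : IsDualSubgroup e eH iH iHs M)
    (hDH : IsDrinfeldDouble eH jH jHs) {V : Set Hs} (hV : IsOpen V)
    (hC : ∀ l ∈ V, IsUnit (constraintMatrix hD hM b (iHs l)).det) (hl : l ∈ V)
    (x : Hs.lie) (β γ : Module.Dual 𝕜 G.lie) :
    TensorProduct.dualDistrib 𝕜 G.lie G.lie (β ⊗ₜ[𝕜] γ)
        (leftDerivVec (fun l => rho iK hD hM b (iHs l)) x l) =
      hD.form (dHom jK (rhoMap hD hM b (iHs l) (e.symm (β ∘ₗ dHom iK))) +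
          dHom jKs (hM.dualProj (e.symm (β ∘ₗ dHom iK))))
        ⁅dHom jKs (dHom iHs x), dHom jK (rhoMap hD hM b (iHs l) (e.symm (γ ∘ₗ dHom iK))) +
          dHom jKs (hM.dualProj (e.symm (γ ∘ₗ dHom iK)))⁆ := by
  rw [dual_leftDerivVec (hS.vdiffAt_rho iK hV hC hl)]
  simp only [dualDistrib_rho]
  exact hS.leftDeriv_rhoMap hDH hV hC hl x _ _

/-- `ρ` is infinitesimally equivariant. -/
lemma dress_rho (hiK : IsLieSubgroup iK) (hS : IsDualSubgroup e eH iH iHs M)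
    (hDH : IsDrinfeldDouble eH jH jHs) {V : Set Hs} (hV : IsOpen V)
    (hC : ∀ l ∈ V, IsUnit (constraintMatrix hD hM b (iHs l)).det) (hl : l ∈ V) (X : H.lie) :
    leftDerivVec (fun l => rho iK hD hM b (iHs l)) (Ad l (conjKs hDH l⁻¹ X)) l =
      adTensor (dHom iK (dHom iH X)) (rho iK hD hM b (iHs l)) := by
  refine tensor_ext fun β γ => ?_
  rw [hS.dualDistrib_leftDerivVec_rho iK hDH hV hC hl, hS.dHom_Ad_conjKs hDH hM hD,
    dHom_Ad_conjKs_inv hD, dualDistrib_adTensor _ _ _ (hS.isAntisymm_rho iK hDH (hC l hl)),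
    contr_rho, contr_rho, ← dHom_lie hiK.smooth, ← dHom_lie hiK.smooth]
  have hβ : ∀ u, β (dHom iK u) = e (e.symm (β ∘ₗ dHom iK)) u := fun u => by
    rw [LinearEquiv.apply_symm_apply]; rfl
  have hγ : ∀ u, γ (dHom iK u) = e (e.symm (γ ∘ₗ dHom iK)) u := fun u => by
    rw [LinearEquiv.apply_symm_apply]; rfl
  rw [hβ, hγ]
  generalize e.symm (β ∘ₗ dHom iK) = y
  generalize e.symm (γ ∘ₗ dHom iK) = z
  -- the term `λ (λ⁻¹ X λ)_𝒦 λ⁻¹` does not contribute, since `λ 𝒦 λ⁻¹` is an isotropic subalgebra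
  have h0 : hD.form (dHom jK (rhoMap hD hM b (iHs l) y) + dHom jKs (hM.dualProj y))
      ⁅Ad (jKs (iHs l)) (dHom jK (conjK hD (iHs l)⁻¹ (dHom iH X))),
        dHom jK (rhoMap hD hM b (iHs l) z) + dHom jKs (hM.dualProj z)⁆ = 0 := by
    rw [← hS.Ad_rhoSol hDH (hC l hl), ← hS.Ad_rhoSol hDH (hC l hl), ← Ad_lie, hS.form_Ad hD,
      ← dHom_lie hD.subgroup.smooth, hD.form_K_K]
  rw [sub_lie, map_sub, h0, sub_zero]
  have hmem : ∀ y, ⁅dHom iH X, (rhoMap hD hM b (iHs l) y : K.lie)⁆ ∈ M := fun y =>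
    hM.reductive _ ⟨X, rfl⟩ _ (Subtype.mem _)
  have h1 : hD.form (dHom jK (rhoMap hD hM b (iHs l) y)) ⁅dHom jK (dHom iH X),
      dHom jKs (hM.dualProj z)⁆ = -e z ⁅dHom iH X, (rhoMap hD hM b (iHs l) y : K.lie)⁆ := by
    rw [← hD.form_lie, ← dHom_lie hD.subgroup.smooth, hD.form_K_Ks, ← lie_skew, map_neg,
      hM.dualProj_of_mem_left z (hmem y)]
  have h2 : hD.form (dHom jKs (hM.dualProj y)) ⁅dHom jK (dHom iH X),
      dHom jKs (hM.dualProj z)⁆ = 0 := by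
    rw [hD.form_symm, hD.form_lie, ← dHom_lie hD.dual_subgroup.smooth, hD.form_K_Ks,
      apply_lie_dualProj hM]
  rw [lie_add, ← dHom_lie hD.subgroup.smooth, map_add, map_add, LinearMap.add_apply,
    LinearMap.add_apply, h1, h2, hD.form_K_K, hD.form_Ks_K, hM.dualProj_of_mem_left y (hmem z)]
  ring

end Connected

end IsDualSubgroup

lemma IsTriangularDynamicalRMatrix.zero {G K Ks D : FDLieGroup 𝕜}
    {e : Ks.lie ≃ₗ[𝕜] Module.Dual 𝕜 K.lie} {jK : K →* D} {jKs : Ks →* D} {R : G.lie ⊗[𝕜] G.lie}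
    (hR : IsAntisymm R) (iK : K →* G) (hD : IsDrinfeldDouble e jK jKs) {U : Set Ks}
    (hU : IsOpen U) : IsTriangularDynamicalRMatrix R iK hD U fun _ => 0 := by
  have hs : SmoothOn (fun _ : Ks => (0 : G.lie ⊗[𝕜] G.lie)) U := fun ψ => contMDiffOn_const
  have hz : ∀ κ ∈ U, ∀ x, leftDerivVec (fun _ : Ks => (0 : G.lie ⊗[𝕜] G.lie)) x κ = 0 := by
    intro κ hκ x
    refine eq_of_forall_dual (𝕜 := 𝕜) fun ψ => ?_
    rw [dual_leftDerivVec (hs.vdiffAt hU hκ), leftDeriv_const, map_zero]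
  refine ⟨hs, fun κ _ => by simp [IsAntisymm], fun κ hκ X => ?_, fun κ hκ => ?_⟩
  · rw [dress, rightDerivVec_eq_leftDerivVec (hs.vdiffAt hU hκ), hz κ hκ, adTensor_zero]
  · simp only [hz κ hκ, TensorProduct.tmul_zero, Finset.sum_const_zero, add_zero]
    exact cycl_br12_23_self hR

lemma IsDualGroup.apply_lie {G K Ks : FDLieGroup 𝕜} {R : G.lie ⊗[𝕜] G.lie} {iK : K →* G}
    {e : Ks.lie ≃ₗ[𝕜] Module.Dual 𝕜 K.lie} (he : IsDualGroup R iK e) (hR : IsAntisymm R)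
    (β γ : Module.Dual 𝕜 G.lie) (X : K.lie) :
    e ⁅e.symm (β ∘ₗ dHom iK), e.symm (γ ∘ₗ dHom iK)⁆ X =
      γ ⁅dHom iK X, contr β R⁆ - β ⁅dHom iK X, contr γ R⁆ := by
  rw [he _ _ β γ (e.apply_symm_apply _).symm (e.apply_symm_apply _).symm,
    dualDistrib_adTensor _ _ _ hR, neg_sub]

namespace IsDualSubgroup

variable {G K Ks D H Hs DH : FDLieGroup 𝕜} {e : Ks.lie ≃ₗ[𝕜] Module.Dual 𝕜 K.lie}
  {jK : K →* D} {jKs : Ks →* D}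
  {eH : Hs.lie ≃ₗ[𝕜] Module.Dual 𝕜 H.lie} {jH : H →* DH} {jHs : Hs →* DH}
  {iK : K →* G} {iH : H →* K} {iHs : Hs →* Ks} {M : Submodule 𝕜 K.lie}
  {R : G.lie ⊗[𝕜] G.lie}
  {hM : IsReductiveDecomposition e (LinearMap.range (dHom iH)) M}
  {hD : IsDrinfeldDouble e jK jKs} {hDH : IsDrinfeldDouble eH jH jHs}
  {ι : Type*} [Fintype ι] [DecidableEq ι] {b : Module.Basis ι 𝕜 M}
  {U : Set Ks} {V : Set Hs} {r : Ks → G.lie ⊗[𝕜] G.lie} {l : Hs}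

/-- The restriction of `φ` to `ℋ`, seen in `ℋ* ⊂ 𝒦*`, is the component of `φ` in `ℋ*`. -/
lemma dHom_symm_comp (hS : IsDualSubgroup e eH iH iHs M)
    (hM : IsReductiveDecomposition e (LinearMap.range (dHom iH)) M) (φ : Module.Dual 𝕜 K.lie) :
    dHom iHs (eH.symm (φ ∘ₗ dHom iH)) = e.symm φ - hM.dualProj (e.symm φ) := by
  refine hM.dual_ext (fun X hX => ?_) ?_
  · rw [hS.apply_of_mem _ hX, map_sub, LinearMap.sub_apply, hM.dualProj_of_mem_left _ hX, sub_self]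
  · rintro _ ⟨Y, rfl⟩
    rw [← hS.pairing, LinearEquiv.apply_symm_apply, map_sub, LinearMap.sub_apply,
      hM.dualProj_of_mem_right _ ⟨Y, rfl⟩, sub_zero, LinearEquiv.apply_symm_apply]
    rfl

variable [ConnectedSpace Hs]

/-- On the points of `H*`, the equivariance of `r` expresses its derivatives along `ℳ*` without
differentiation. -/
lemma leftDerivVec_sub_dualProj (hS : IsDualSubgroup e eH iH iHs M)
    (hDH : IsDrinfeldDouble eH jH jHs) (hU : IsOpen U)
    (hr : IsTriangularDynamicalRMatrix R iK hD U r) (hl : iHs l ∈ U)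
    (hC : IsUnit (constraintMatrix hD hM b (iHs l)).det) (x : Ks.lie) :
    leftDerivVec r (x - hM.dualProj x) (iHs l) =
      leftDerivVec r x (iHs l) + adTensor (dHom iK (rhoMap hD hM b (iHs l) x)) (r (iHs l)) := by
  rw [← hr.equivariant _ hl, dress, rightDerivVec_eq_leftDerivVec (hr.smooth.vdiffAt hU hl),
    hS.Ad_conjKs_rhoMap hDH hC, sub_eq_add_neg, ← leftDerivVecLin_apply, map_add,
    leftDerivVecLin_apply, leftDerivVecLin_apply]

/-- The left-hand side of the dynamical Yang-Baxter equation of `r + ρ`, before the cyclic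
summation, as the one of `r` plus a correction. -/
lemma pair3_cdybe_add_rho (hS : IsDualSubgroup e eH iH iHs M) (hDH : IsDrinfeldDouble eH jH jHs)
    (hiK : IsLieSubgroup iK) (hR : IsAntisymm R) (hU : IsOpen U)
    (hr : IsTriangularDynamicalRMatrix R iK hD U r) (hV : IsOpen V) (hVU : MapsTo iHs V U)
    (hC : ∀ l ∈ V, IsUnit (constraintMatrix hD hM b (iHs l)).det) (hl : l ∈ V)
    {P : Ks.lie → K.lie} (hP : ∀ y, P y = rhoMap hD hM b (iHs l) y)
    (α β γ : Module.Dual 𝕜 G.lie) {x y z : Ks.lie} (hx : x = e.symm (α ∘ₗ dHom iK))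
    (hy : y = e.symm (β ∘ₗ dHom iK)) (hz : z = e.symm (γ ∘ₗ dHom iK)) :
    pair3 α β γ (br12_23 (R + (r (iHs l) + rho iK hD hM b (iHs l)))
          (R + (r (iHs l) + rho iK hD hM b (iHs l))) +
        ∑ a, dHom (iK.comp iH) (Module.finBasis 𝕜 H.lie a) ⊗ₜ[𝕜]
          leftDerivVec (fun l => r (iHs l) + rho iK hD hM b (iHs l))
            (eH.symm ((Module.finBasis 𝕜 H.lie).coord a)) l) =
      pair3 α β γ (br12_23 (R + r (iHs l)) (R + r (iHs l)) +
        ∑ a, dHom iK (Module.finBasis 𝕜 K.lie a) ⊗ₜ[𝕜]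
          leftDerivVec r (e.symm ((Module.finBasis 𝕜 K.lie).coord a)) (iHs l)) -
      β ⁅contr α R, dHom iK (P z)⁆ - β ⁅dHom iK (P x), contr γ R⁆ -
      β ⁅contr α (r (iHs l)), dHom iK (P z)⁆ - γ ⁅dHom iK (P x), contr β (r (iHs l))⁆ -
      e y ⁅P x, P z⁆ +
      hD.form (dHom jK (P y) + dHom jKs (hM.dualProj y))
        ⁅dHom jKs (x - hM.dualProj x), dHom jK (P z) + dHom jKs (hM.dualProj z)⁆ := by
  have hrl := hr.antisymm _ (hVU hl)
  have hρ := hS.isAntisymm_rho iK hDH (hC l hl)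
  have hd := hr.smooth.vdiffAt hU (hVU hl)
  have hcomp : dHom (iK.comp iH) = dHom iK ∘ₗ dHom iH := dHom_comp hiK.smooth hS.subgroup.smooth
  have hx' : dHom iHs (eH.symm ((α ∘ₗ dHom iK) ∘ₗ dHom iH)) = x - hM.dualProj x := by
    rw [hS.dHom_symm_comp hM, hx]
  have hyP : e y ⁅P x, P z⁆ = β ⁅dHom iK (P x), dHom iK (P z)⁆ := by
    rw [hy, LinearEquiv.apply_symm_apply, ← dHom_lie hiK.smooth]
    rfl
  rw [map_add, map_add,
    pair3_br12_23_of_isAntisymm _ _ _ (isAntisymm_add hR (isAntisymm_add hrl hρ)),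
    pair3_br12_23_of_isAntisymm _ _ _ (isAntisymm_add hR hrl), pair3_sum_leftDerivVec,
    pair3_sum_leftDerivVec, hcomp, ← LinearMap.comp_assoc,
    leftDerivVec_add (hd.comp_hom hS.dual_subgroup.smooth) (hS.vdiffAt_rho iK hV hC hl),
    leftDerivVec_comp_hom hS.dual_subgroup.smooth hd, map_add (TensorProduct.dualDistrib 𝕜 _ _ _),
    hS.dualDistrib_leftDerivVec_rho iK hDH hV hC hl, hx',
    hS.leftDerivVec_sub_dualProj hDH hU hr (hVU hl) (hC l hl),
    map_add (TensorProduct.dualDistrib 𝕜 _ _ _), dualDistrib_adTensor _ _ _ hrl, hyP]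
  simp only [map_add, contr_rho, add_lie, lie_add, ← hx, ← hy, ← hz, ← hP]
  ring

/-- Adding `ρ` reduces a dynamical `r`-matrix for `K ⊆ G` to one for `H ⊂ G`. In the cyclic sum, the
corrections that involve the value of `r` cancel, and the remaining ones do not depend on `r`. -/
lemma isTriangularDynamicalRMatrix_add_rho (hS : IsDualSubgroup e eH iH iHs M)
    (hDH : IsDrinfeldDouble eH jH jHs) (hiK : IsLieSubgroup iK) (hR : IsAntisymm R)
    (he : IsDualGroup R iK e) (hU : IsOpen U) (hr : IsTriangularDynamicalRMatrix R iK hD U r)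
    (hV : IsOpen V) (hVU : MapsTo iHs V U)
    (hC : ∀ l ∈ V, IsUnit (constraintMatrix hD hM b (iHs l)).det) :
    IsTriangularDynamicalRMatrix R (iK.comp iH) hDH V
      (fun l => r (iHs l) + rho iK hD hM b (iHs l)) := by
  have hsmooth := hS.dual_subgroup.smooth
  have hd : ∀ l ∈ V, VDiffAt r (iHs l) := fun l hl => hr.smooth.vdiffAt hU (hVU hl)
  refine ⟨fun ψ => ?_, fun l hl => isAntisymm_add (hr.antisymm _ (hVU hl))
    (hS.isAntisymm_rho iK hDH (hC l hl)), fun l hl X => ?_, fun l hl => ?_⟩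
  · simp only [map_add]
    exact ((hr.smooth ψ).comp hsmooth.contMDiffOn hVU).add (hS.smoothOn_rho iK hC ψ)
  · have h1 := (hd l hl).comp_hom hsmooth
    have h2 := hS.vdiffAt_rho iK hV hC hl
    rw [dress, rightDerivVec_eq_leftDerivVec (h1.add h2), leftDerivVec_add h1 h2,
      leftDerivVec_comp_hom hsmooth (hd l hl), hS.dHom_Ad_conjKs hDH hM hD,
      ← rightDerivVec_eq_leftDerivVec (hd l hl), hS.dress_rho hiK hDH hV hC hl,
      dHom_comp hiK.smooth hS.subgroup.smooth, LinearMap.comp_apply, adTensor_add,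
      ← hr.equivariant _ (hVU hl)]
    rfl
  · rw [← hr.cdybe _ (hVU hl)]
    refine tensor3_ext fun α β γ => ?_
    have hsum := hS.cyclic_sum_rhoMap hDH (hC l hl)
      (P := fun y => rhoMap hD hM b (iHs l) y) (fun _ => rfl) (fun _ _ _ => rfl)
      (e.symm (α ∘ₗ dHom iK)) (e.symm (β ∘ₗ dHom iK)) (e.symm (γ ∘ₗ dHom iK))
    have key := hS.pair3_cdybe_add_rho hDH hiK hR hU hr hV hVU hC hl
      (P := fun y => rhoMap hD hM b (iHs l) y) fun _ => rfl
    have hskew : ∀ (φ : Module.Dual 𝕜 G.lie) (X Y : G.lie), φ ⁅X, Y⁆ = -φ ⁅Y, X⁆ := fun φ X Y => by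
      rw [← lie_skew, map_neg]
    rw [pair3_cycl, pair3_cycl, key α β γ rfl rfl rfl, key γ α β rfl rfl rfl,
      key β γ α rfl rfl rfl, hskew β (contr α _), hskew β (contr α _), hskew α (contr γ _),
      hskew α (contr γ _), hskew γ (contr β _), hskew γ (contr β _)]
    simp only [he.apply_lie hR] at hsum
    linear_combination hsum

end IsDualSubgroup

end PoissonLie

end

end

theorem corollary3p7 {𝕜 : Type*} [RCLike 𝕜]
    -- `H ⊂ K ⊆ G`: connected Poisson-Lie groups, `G` of coboundary type
    (G K H : PoissonLie.FDLieGroup 𝕜)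
    [ConnectedSpace G] [ConnectedSpace K] [ConnectedSpace H]
    (R : G.lie ⊗[𝕜] G.lie) (hR : PoissonLie.IsConstantRMatrix R)
    (iK : K →* G) (hK : PoissonLie.IsPoissonLieSubgroup R iK)
    (iH : H →* K) (hiH : PoissonLie.IsLieSubgroup iH)
    (hH : PoissonLie.IsPoissonLieSubgroup R (iK.comp iH))
    -- the dual group `K*` and the double `D(K, K*)`
    (Ks D : PoissonLie.FDLieGroup 𝕜)
    (e : Ks.lie ≃ₗ[𝕜] Module.Dual 𝕜 K.lie) (he : PoissonLie.IsDualGroup R iK e)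
    (jK : K →* D) (jKs : Ks →* D) (hD : PoissonLie.IsDrinfeldDouble e jK jKs)
    -- the decomposition `𝒦 = ℋ + ℳ` and a basis of `ℳ`
    (M : Submodule 𝕜 K.lie)
    (hM : PoissonLie.IsReductiveDecomposition e (LinearMap.range (PoissonLie.dHom iH)) M)
    {ι : Type*} [Fintype ι] [DecidableEq ι] (b : Module.Basis ι 𝕜 M)
    -- the connected subgroup `H* ⊂ K*` with Lie algebra `ℋ* = ℳ^⊥`, and the double `D(H, H*)`
    (Hs DH : PoissonLie.FDLieGroup 𝕜) [ConnectedSpace Hs]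
    (iHs : Hs →* Ks) (hiHs : PoissonLie.IsLieSubgroup iHs)
    (hHs : ∀ x : Ks.lie,
      x ∈ LinearMap.range (PoissonLie.dHom iHs) ↔ e x ∈ M.dualAnnihilator)
    (eH : Hs.lie ≃ₗ[𝕜] Module.Dual 𝕜 H.lie)
    (heH : ∀ (x : Hs.lie) (Y : H.lie),
      eH x Y = e (PoissonLie.dHom iHs x) (PoissonLie.dHom iH Y))
    (jH : H →* DH) (jHs : Hs →* DH) (hDH : PoissonLie.IsDrinfeldDouble eH jH jHs)
    -- a triangular dynamical `r`-matrix on the open set `U ⊆ K*`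
    (U : Set Ks) (hU : IsOpen U) (r : Ks → G.lie ⊗[𝕜] G.lie)
    (hr : PoissonLie.IsTriangularDynamicalRMatrix R iK hD U r)
    -- a non-empty open submanifold `V` of `H*`, contained in `U`
    (V : Set Hs) (hV : IsOpen V) (hVne : V.Nonempty) (hVU : Set.MapsTo iHs V U)
    (hC : ∀ l ∈ V, IsUnit (PoissonLie.constraintMatrix hD hM b (iHs l)).det) :
    -- `H*` is the dual group of `H ⊂ G`, and `r* = r + ρ` is a triangular dynamical `r`-matrix
    PoissonLie.IsDualGroup R (iK.comp iH) eH ∧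
    PoissonLie.IsTriangularDynamicalRMatrix R (iK.comp iH) hDH V
      (fun l => r (iHs l) + PoissonLie.rho iK hD hM b (iHs l)) ∧
    -- the case `r = 0`: `ρ` itself is one, and it is the Enriquez-Etingof-Marshall family
    PoissonLie.IsTriangularDynamicalRMatrix R (iK.comp iH) hDH V
      (fun l => PoissonLie.rho iK hD hM b (iHs l)) ∧
    ∀ l ∈ V, ∀ s : M ⊗[𝕜] M,
      PoissonLie.IsEEMSigma hD hM (iHs l) s ↔ s = PoissonLie.rhoM hD hM b (iHs l) := by
  have hS : PoissonLie.IsDualSubgroup e eH iH iHs M := ⟨hiH, hiHs, hHs, heH⟩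
  have hrho := hS.isTriangularDynamicalRMatrix_add_rho hDH hK.toIsLieSubgroup hR.antisymm he hU
    (PoissonLie.IsTriangularDynamicalRMatrix.zero hR.antisymm iK hD hU) hV hVU hC
  simp only [zero_add] at hrho
  exact ⟨hS.isDualGroup hM hK.toIsLieSubgroup he,
    hS.isTriangularDynamicalRMatrix_add_rho hDH hK.toIsLieSubgroup hR.antisymm he hU hr hV hVU hC,
    hrho, fun l hl s => hS.isEEMSigma_iff hDH (hC l hl) s⟩
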